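/- Let $\Omega=(0,1)^2$. There is an absolute constant $c>0$ such that the following holds. Let $u\in C^4(\bar\Omega)$ and $f\in C(\bar\Omega)$ satisfy $-\Delta u=f$ in $\Omega$ and $u=0$ on $\partial\Omega$, and put $\|u\|_{4,\infty,\bar\Omega}=\max_{|\alpha|\le 4}\max_{\bar\Omega}|D^\alpha u|$. Let $\tau$ be any admissible rectangular mesh: $M,N\ge 1$; cell widths $h_1,\dots,h_M>0$ and $k_1,\dots,k_N>0$ with $\sum_i h_i=\sum_j k_j=1$, and $h_0=h_{M+1}=k_0=k_{N+1}=0$; faces $x_{1/2}=0$, $x_{i+1/2}=x_{i-1/2}+h_i$ and $y_{1/2}=0$, $y_{j+1/2}=y_{j-1/2}+k_j$; points $x_0=0$, $x_{M+1}=1$, $x_{i-1/2}<x_i<x_{i+1/2}$ for $1\le i\le M$, and $y_0=0$, $y_{N+1}=1$, $y_{j-1/2}<y_j<y_{j+1/2}$ for $1\le j\le N$. Write $K_{ij}=[x_{i-1/2},x_{i+1/2}]\times[y_{j-1/2},y_{j+1/2}]$, $h_i^-=x_i-x_{i-1/2}$, $h_i^+=x_{i+1/2}-x_i$, $h_{i+1/2}=x_{i+1}-x_i$,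 $k_j^-=y_j-y_{j-1/2}$, $k_j^+=y_{j+1/2}-y_j$, $k_{j+1/2}=y_{j+1}-y_j$, with $h_0^+=h_{M+1}^-=k_0^+=k_{N+1}^-=0$, and $h=\max\{h_i,k_j\}$. For $w=(w_{ij})_{0\le i\le M+1,\,0\le j\le N+1}$ and $1\le i\le M$, $1\le j\le N$ let $$(\Delta^\tau w)_{ij}=-k_j\Big(\frac{w_{i+1,j}-w_{ij}}{h_{i+1/2}}-\frac{w_{ij}-w_{i-1,j}}{h_{i-1/2}}\Big)-h_i\Big(\frac{w_{i,j+1}-w_{ij}}{k_{j+1/2}}-\frac{w_{ij}-w_{i,j-1}}{k_{j-1/2}}\Big),$$ and let $\partial_1^xw_{ij}=(w_{i+1,j}-w_{ij})/h_{i+1/2}$, $\partial_1^yw_{ij}=(w_{i,j+1}-w_{ij})/k_{j+1/2}$. Then each of the following three discrete problems has a unique solution (the equations being imposed for $1\le i\le M$, $1\le j\le N$): (a) the basic finite volume scheme $(\Delta^\tau u^h)_{ij}=\int_{K_{ij}}f\,dx\,dy$, with $u^h=(u_{ij})$ zero at the boundary indices ($i\in\{0,M+1\}$ or $j\in\{0,N+1\}$);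 (b) the finite volume approximation $v^h=(v_{ij})$ of $u_{xx}$: $(\Delta^\tau v^h)_{ij}=\int_{K_{ij}}f_{xx}\,dx\,dy$, with $v_{i0}=v_{i,N+1}=0$, $v_{0j}=-f(0,y_j)$, $v_{M+1,j}=-f(1,y_j)$; (c) the first correction $u^h_1=(u^1_{ij})$, zero at the boundary indices, with $$(\Delta^\tau u^h_1)_{ij}=\int_{K_{ij}}f\,dx\,dy+(\gamma_{i+1/2,j}-\gamma_{i-1/2,j})+(\gamma_{i,j+1/2}-\gamma_{i,j-1/2})+\delta_{ij},$$ where $\gamma_{i+1/2,j}=-k_j\frac{h_{i+1}^--h_i^+}{2}v_{ij}$, $\ \gamma_{i,j+1/2}=-h_i\frac{k_{j+1}^--k_j^+}{2}\big(-f(x_i,y_{j+1/2})-v_{ij}\big)$ and $$\delta_{ij}=h_i\tfrac{(k_j^+)^2}{2}\partial_1^yv_{ij}-h_i\tfrac{(k_j^-)^2}{2}\partial_1^yv_{i,j-1}+k_j\tfrac{(h_i^+)^2}{2}\big(-f_x(x_i,y_j)-\partial_1^xv_{ij}\big)-k_j\tfrac{(h_i^-)^2}{2}\big(-f_x(x_{i-1},y_j)-\partial_1^xv_{i-1,j}\big).$$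 Moreover, if $e^1_{ij}=u(x_i,y_j)-u^1_{ij}$ for $1\le i\le M$, $1\le j\le N$ and $e^1_{ij}=0$ elsewhere, then $$\|e^1\|_{1,\tau}:=\Big(\sum_{i=0}^M\sum_{j=0}^N k_j\frac{(e^1_{i+1,j}-e^1_{ij})^2}{h_{i+1/2}}+\sum_{i=0}^M\sum_{j=0}^N h_i\frac{(e^1_{i,j+1}-e^1_{ij})^2}{k_{j+1/2}}\Big)^{1/2}\le c\,h^2\|u\|_{4,\infty,\bar\Omega},$$ $$\Big(\sum_{i=0}^M\sum_{j=0}^N k_jh_{i+1/2}(e^1_{ij})^2\Big)^{1/2}\le c\,h^2\|u\|_{4,\infty,\bar\Omega},\qquad \|e^1\|_{L^2}:=\Big(\sum_{i=0}^M\sum_{j=0}^N h_ik_j(e^1_{ij})^2\Big)^{1/2}\le c\,h^2\|u\|_{4,\infty,\bar\Omega}.$$ -/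

import Mathlib

open Set MeasureTheory

noncomputable section

namespace FVCorrection

/-! ### Functions on the unit square -/

/-- The domain `Ω = (0,1)²`. -/
def openSquare : Set (ℝ × ℝ) := Ioo 0 1 ×ˢ Ioo 0 1

/-- The closure of the domain, `[0,1]²`. -/
def closedSquare : Set (ℝ × ℝ) := Icc 0 1 ×ˢ Icc 0 1

/-- Partial derivative in `x` on the closed square: the usual partial derivative at interior
points, the one-sided one on the sides `x = 0` and `x = 1`. -/
def partialX (w : ℝ × ℝ → ℝ) (p : ℝ × ℝ) : ℝ :=
  derivWithin (fun s : ℝ => w (s, p.2)) (Icc 0 1) p.1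

/-- Partial derivative in `y` on the closed square (one-sided on `y = 0` and `y = 1`). -/
def partialY (w : ℝ × ℝ → ℝ) (p : ℝ × ℝ) : ℝ :=
  derivWithin (fun t : ℝ => w (p.1, t)) (Icc 0 1) p.2

/-- `D^α w` for the multi-index `α = (a, b)`. -/
def partialD (a b : ℕ) (w : ℝ × ℝ → ℝ) : ℝ × ℝ → ℝ :=
  partialX^[a] (partialY^[b] w)

/-- The norm of `C^m` of the closed square: the maximum over `|α| ≤ m` and over the closed square
of `|D^α w|`. -/
def cNorm (m : ℕ) (w : ℝ × ℝ → ℝ) : ℝ :=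
  sSup {r : ℝ | ∃ a b : ℕ, a + b ≤ m ∧ ∃ p ∈ closedSquare, r = |partialD a b w p|}

/-! ### Admissible meshes -/

/-- One direction of an admissible mesh of `(0,1)`: `n ≥ 1` cells of positive widths
`width i = h_i` (`1 ≤ i ≤ n`), faces `face i = x_{i+1/2}` (`0 ≤ i ≤ n`) and points
`node i = x_i` (`0 ≤ i ≤ n + 1`), the point `x_i` lying inside the `i`-th cell for `1 ≤ i ≤ n`.
Values at larger indices play no role. -/
structure Partition where
  n : ℕ
  n_pos : 0 < n
  width : ℕ → ℝ
  width_pos : ∀ i ∈ Finset.Icc 1 n, 0 < width i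
  sum_width : ∑ i ∈ Finset.Icc 1 n, width i = 1
  width_zero : width 0 = 0
  width_last : width (n + 1) = 0
  face : ℕ → ℝ
  face_zero : face 0 = 0
  face_step : ∀ i ∈ Finset.Icc 1 n, face i = face (i - 1) + width i
  node : ℕ → ℝ
  node_zero : node 0 = 0
  node_last : node (n + 1) = 1
  node_mem : ∀ i ∈ Finset.Icc 1 n, face (i - 1) < node i ∧ node i < face i

namespace Partition

variable (P : Partition)

/-- `h_i^- = x_i - x_{i-1/2}`. For `i = n + 1` this is `0`, since `x_{n+1} = x_{n+1/2} = 1`. -/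
def minus (i : ℕ) : ℝ := P.node i - P.face (i - 1)

/-- `h_i^+ = x_{i+1/2} - x_i`. For `i = 0` this is `0`, since `x_0 = x_{1/2} = 0`. -/
def plus (i : ℕ) : ℝ := P.face i - P.node i

/-- `h_{i+1/2} = x_{i+1} - x_i`. -/
def half (i : ℕ) : ℝ := P.node (i + 1) - P.node i

/-- The `i`-th closed cell `[x_{i-1/2}, x_{i+1/2}]`. -/
def cell (i : ℕ) : Set ℝ := Icc (P.face (i - 1)) (P.face i)

/-- The largest width of a cell. -/
def size : ℝ :=
  (Finset.Icc 1 P.n).sup' (Finset.nonempty_Icc.mpr P.n_pos) P.width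

theorem plus_zero : P.plus 0 = 0 := by
  simp [plus, P.face_zero, P.node_zero]

theorem minus_last : P.minus (P.n + 1) = 0 := by
  have key : ∀ m, m ≤ P.n → P.face m = ∑ i ∈ Finset.Icc 1 m, P.width i := by
    intro m
    induction m with
    | zero => intro _; simp [P.face_zero]
    | succ m ih =>
      intro hm
      rw [P.face_step (m + 1) (Finset.mem_Icc.mpr ⟨by omega, hm⟩), Nat.add_sub_cancel,
        ih (by omega), Finset.sum_Icc_succ_top (by omega)]
  simp [minus, P.node_last, key P.n le_rfl, P.sum_width]

end Partition

/-- An admissible rectangular mesh `τ` of the unit square: the cells are `K_ij = Kx_i × Ky_j`,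
`1 ≤ i ≤ M`, `1 ≤ j ≤ N`, where `M = X.n`, `N = Y.n`; the widths are `h_i = X.width i` and
`k_j = Y.width j`. -/
structure Mesh where
  X : Partition
  Y : Partition

namespace Mesh

variable (τ : Mesh)

/-- The mesh size `h`, the maximum of all `h_i` and `k_j`. -/
def size : ℝ := max τ.X.size τ.Y.size

/-- The control volume `K_ij`. -/
def cell (i j : ℕ) : Set (ℝ × ℝ) := τ.X.cell i ×ˢ τ.Y.cell j

/-- The discretization point `(x_i, y_j)`. -/
def node (i j : ℕ) : ℝ × ℝ := (τ.X.node i, τ.Y.node j)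

/-! A discrete function is a family `w i j`, of which only the values with
`0 ≤ i ≤ M + 1` and `0 ≤ j ≤ N + 1` matter. -/

/-- The five-point operator
`-k_j ((w_{i+1,j} - w_{ij}) / h_{i+1/2} - (w_{ij} - w_{i-1,j}) / h_{i-1/2})
 - h_i ((w_{i,j+1} - w_{ij}) / k_{j+1/2} - (w_{ij} - w_{i,j-1}) / k_{j-1/2})`,
used for `1 ≤ i ≤ M`, `1 ≤ j ≤ N`. -/
def lap (w : ℕ → ℕ → ℝ) (i j : ℕ) : ℝ :=
  -τ.Y.width j * ((w (i + 1) j - w i j) / τ.X.half i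
      - (w i j - w (i - 1) j) / τ.X.half (i - 1))
  - τ.X.width i * ((w i (j + 1) - w i j) / τ.Y.half j
      - (w i j - w i (j - 1)) / τ.Y.half (j - 1))

/-- `w` is the solution of the five-point scheme with right-hand sides `rhs i j` on the cells and
prescribed values `bdry i j` at the boundary indices; outside the index range
`0 ≤ i ≤ M + 1`, `0 ≤ j ≤ N + 1` it is set to `0` so that `w` is determined as a function. -/
structure IsSolution (bdry rhs w : ℕ → ℕ → ℝ) : Prop where
  left : ∀ j ≤ τ.Y.n + 1, w 0 j = bdry 0 j
  right : ∀ j ≤ τ.Y.n + 1, w (τ.X.n + 1) j = bdry (τ.X.n + 1) j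
  bottom : ∀ i ≤ τ.X.n + 1, w i 0 = bdry i 0
  top : ∀ i ≤ τ.X.n + 1, w i (τ.Y.n + 1) = bdry i (τ.Y.n + 1)
  scheme : ∀ i ∈ Finset.Icc 1 τ.X.n, ∀ j ∈ Finset.Icc 1 τ.Y.n, τ.lap w i j = rhs i j
  outside : ∀ i j, τ.X.n + 1 < i ∨ τ.Y.n + 1 < j → w i j = 0

/-- The discrete `H^1_0` norm. -/
def normH1 (w : ℕ → ℕ → ℝ) : ℝ :=
  Real.sqrt
    (∑ i ∈ Finset.range (τ.X.n + 1), ∑ j ∈ Finset.range (τ.Y.n + 1),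
        τ.Y.width j * ((w (i + 1) j - w i j) ^ 2 / τ.X.half i)
      + ∑ i ∈ Finset.range (τ.X.n + 1), ∑ j ∈ Finset.range (τ.Y.n + 1),
        τ.X.width i * ((w i (j + 1) - w i j) ^ 2 / τ.Y.half j))

/-- The discrete `L^2` norm, with weights `h_i k_j`. -/
def normL2 (w : ℕ → ℕ → ℝ) : ℝ :=
  Real.sqrt (∑ i ∈ Finset.range (τ.X.n + 1), ∑ j ∈ Finset.range (τ.Y.n + 1),
    τ.X.width i * τ.Y.width j * w i j ^ 2)

/-- The modified discrete `L^2` norm, with weights `k_j h_{i+1/2}`. -/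
def normL2Mod (w : ℕ → ℕ → ℝ) : ℝ :=
  Real.sqrt (∑ i ∈ Finset.range (τ.X.n + 1), ∑ j ∈ Finset.range (τ.Y.n + 1),
    τ.Y.width j * τ.X.half i * w i j ^ 2)

/-! ### The three finite volume schemes -/

/-- `uh` is the basic finite volume solution: homogeneous boundary values and right-hand sides
`∫_{K_ij} f`. -/
def IsBasic (f : ℝ × ℝ → ℝ) (uh : ℕ → ℕ → ℝ) : Prop :=
  τ.IsSolution (fun _ _ => 0) (fun i j => ∫ p in τ.cell i j, f p) uh

/-- Boundary values for the approximation of `u_xx`: `0` on the horizontal sides `j = 0` and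
`j = N + 1`, and `-f` at `(0, y_j)` and `(1, y_j)` for `1 ≤ j ≤ N`. -/
def bdryV (f : ℝ × ℝ → ℝ) (i j : ℕ) : ℝ :=
  if j = 0 ∨ j = τ.Y.n + 1 then 0 else -f (τ.node i j)

/-- `v` is the finite volume approximation of `u_xx`: the five-point scheme with right-hand sides
`∫_{K_ij} f_xx`. -/
def IsApproxUxx (f : ℝ × ℝ → ℝ) (v : ℕ → ℕ → ℝ) : Prop :=
  τ.IsSolution (τ.bdryV f) (fun i j => ∫ p in τ.cell i j, partialX (partialX f) p) v

/-- Forward divided difference in `x`. -/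
def dX (w : ℕ → ℕ → ℝ) (i j : ℕ) : ℝ := (w (i + 1) j - w i j) / τ.X.half i

/-- Forward divided difference in `y`. -/
def dY (w : ℕ → ℕ → ℝ) (i j : ℕ) : ℝ := (w i (j + 1) - w i j) / τ.Y.half j

/-- `γ_{i+1/2,j} = -k_j (h_{i+1}^- - h_i^+)/2 v_{ij}`. -/
def gammaX (v : ℕ → ℕ → ℝ) (i j : ℕ) : ℝ :=
  -τ.Y.width j * ((τ.X.minus (i + 1) - τ.X.plus i) / 2) * v i j

/-- `γ_{i,j+1/2} = -h_i (k_{j+1}^- - k_j^+)/2 (-f(x_i, y_{j+1/2}) - v_{ij})`. -/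
def gammaY (f : ℝ × ℝ → ℝ) (v : ℕ → ℕ → ℝ) (i j : ℕ) : ℝ :=
  -τ.X.width i * ((τ.Y.minus (j + 1) - τ.Y.plus j) / 2)
    * (-f (τ.X.node i, τ.Y.face j) - v i j)

/-- The term `δ_{ij}` of the correction. -/
def delta (f : ℝ × ℝ → ℝ) (v : ℕ → ℕ → ℝ) (i j : ℕ) : ℝ :=
  τ.X.width i * (τ.Y.plus j ^ 2 / 2) * τ.dY v i j
  - τ.X.width i * (τ.Y.minus j ^ 2 / 2) * τ.dY v i (j - 1)
  + τ.Y.width j * (τ.X.plus i ^ 2 / 2) * (-partialX f (τ.node i j) - τ.dX v i j)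
  - τ.Y.width j * (τ.X.minus i ^ 2 / 2)
      * (-partialX f (τ.node (i - 1) j) - τ.dX v (i - 1) j)

/-- `u1` is the first correction built from the approximation `v` of `u_xx`. -/
def IsCorrection (f : ℝ × ℝ → ℝ) (v u1 : ℕ → ℕ → ℝ) : Prop :=
  τ.IsSolution (fun _ _ => 0)
    (fun i j => (∫ p in τ.cell i j, f p)
      + (τ.gammaX v i j - τ.gammaX v (i - 1) j)
      + (τ.gammaY f v i j - τ.gammaY f v i (j - 1))
      + τ.delta f v i j) u1

/-- The error `u(x_i, y_j) - w_{ij}` for `1 ≤ i ≤ M`, `1 ≤ j ≤ N`, and `0` elsewhere. -/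
def error (u : ℝ × ℝ → ℝ) (w : ℕ → ℕ → ℝ) (i j : ℕ) : ℝ :=
  if i ∈ Finset.Icc 1 τ.X.n ∧ j ∈ Finset.Icc 1 τ.Y.n then u (τ.node i j) - w i j else 0

end Mesh

end FVCorrection

end

open FVCorrection

/-!
The proof compares the discrete problems with the exact solution through the energy of the
five-point operator, which is the square of the discrete `H^1_0` norm (`Mesh.sum_lap_mul`). Together
with the discrete Poincaré inequality (`Partition.sum_mul_sq_le`) this gives unique solvability
(`Mesh.existsUnique_isSolution`) and, by Young's inequality, a stability estimate
(`Mesh.energy_le`): a perturbation that is a difference of fluxes costs only the size of the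
fluxes, although the scheme is not pointwise consistent on a nonuniform mesh.

By Gauss' theorem the truncation error is a difference of flux errors (`Mesh.lap_nodal`). For
`u_xx`, which is only `C^2`, these are of first order, so `v` approximates `u_xx` with an energy
error of order `h` (`Mesh.energy_uxxError_le`). For `u`, Taylor expansion identifies the first-order
part of a flux error. One contribution is an offset of the side from the midpoint between the
nodes, multiplied by a second normal derivative, and it is cancelled by `gammaX` and `gammaY`.
The other is the first moment of the normal derivative along the side. Its difference between
opposite sides is a third derivative, which `delta` replaces by divided differences of `v`.
What remains is of order `h^2`, or of order `h` times the error of `v` or of its divided differences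
(`Mesh.abs_fluxX_corrected_le`, `Mesh.abs_fluxY_corrected_le`, `Mesh.abs_momentDefect_le`), hence
altogether of order `h^2`.
-/

namespace FVCorrection

/-! ### Calculus on the closed square -/

theorem closedSquare_eq_Icc : closedSquare = Icc ((0, 0) : ℝ × ℝ) (1, 1) :=
  Icc_prod_Icc 0 1 0 1

theorem uniqueDiffOn_closedSquare : UniqueDiffOn ℝ closedSquare :=
  (uniqueDiffOn_Icc zero_lt_one).prod (uniqueDiffOn_Icc zero_lt_one)

theorem isCompact_closedSquare : IsCompact closedSquare :=
  isCompact_Icc.prod isCompact_Icc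

theorem interior_closedSquare : interior closedSquare = openSquare := by
  rw [closedSquare, interior_prod_eq, interior_Icc, openSquare]

theorem closure_openSquare : closure openSquare = closedSquare := by
  simp [closedSquare, openSquare, closure_prod_eq]

theorem frontier_openSquare : frontier openSquare = closedSquare \ openSquare := by
  have ho : IsOpen openSquare := isOpen_Ioo.prod isOpen_Ioo
  rw [ho.frontier_eq, closure_openSquare]

section Slices

variable {g : ℝ × ℝ → ℝ} {p : ℝ × ℝ}

theorem hasDerivWithinAt_fderivX (hg : ContDiffOn ℝ 1 g closedSquare) (hp : p ∈ closedSquare) :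
    HasDerivWithinAt (fun s => g (s, p.2)) (fderivWithin ℝ g closedSquare p (1, 0))
      (Icc 0 1) p.1 := by
  have h1 := ((hg.differentiableOn one_ne_zero) p hp).hasFDerivWithinAt
  have h2 : HasDerivWithinAt (fun s : ℝ => (s, p.2)) ((1 : ℝ), (0 : ℝ)) (Icc 0 1) p.1 :=
    (hasDerivWithinAt_id _ _).prodMk (hasDerivWithinAt_const _ _ _)
  have h3 : MapsTo (fun r : ℝ => (r, p.2)) (Icc 0 1) closedSquare := fun s hs => ⟨hs, hp.2⟩
  exact h1.comp_hasDerivWithinAt p.1 h2 h3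

theorem hasDerivWithinAt_fderivY (hg : ContDiffOn ℝ 1 g closedSquare) (hp : p ∈ closedSquare) :
    HasDerivWithinAt (fun t => g (p.1, t)) (fderivWithin ℝ g closedSquare p (0, 1))
      (Icc 0 1) p.2 := by
  have h1 := ((hg.differentiableOn one_ne_zero) p hp).hasFDerivWithinAt
  have h2 : HasDerivWithinAt (fun t : ℝ => (p.1, t)) ((0 : ℝ), (1 : ℝ)) (Icc 0 1) p.2 :=
    (hasDerivWithinAt_const _ _ _).prodMk (hasDerivWithinAt_id _ _)
  have h3 : MapsTo (fun r : ℝ => (p.1, r)) (Icc 0 1) closedSquare := fun s hs => ⟨hp.1, hs⟩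
  exact h1.comp_hasDerivWithinAt p.2 h2 h3

theorem partialX_eq_fderivWithin (hg : ContDiffOn ℝ 1 g closedSquare) (hp : p ∈ closedSquare) :
    partialX g p = fderivWithin ℝ g closedSquare p (1, 0) :=
  (hasDerivWithinAt_fderivX hg hp).derivWithin (uniqueDiffOn_Icc zero_lt_one _ hp.1)

theorem partialY_eq_fderivWithin (hg : ContDiffOn ℝ 1 g closedSquare) (hp : p ∈ closedSquare) :
    partialY g p = fderivWithin ℝ g closedSquare p (0, 1) :=
  (hasDerivWithinAt_fderivY hg hp).derivWithin (uniqueDiffOn_Icc zero_lt_one _ hp.2)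

theorem hasDerivWithinAt_partialX (hg : ContDiffOn ℝ 1 g closedSquare) {x y : ℝ}
    (hx : x ∈ Icc (0 : ℝ) 1) (hy : y ∈ Icc (0 : ℝ) 1) :
    HasDerivWithinAt (fun s => g (s, y)) (partialX g (x, y)) (Icc 0 1) x := by
  rw [partialX_eq_fderivWithin hg ⟨hx, hy⟩]
  exact hasDerivWithinAt_fderivX (p := (x, y)) hg ⟨hx, hy⟩

theorem hasDerivWithinAt_partialY (hg : ContDiffOn ℝ 1 g closedSquare) {x y : ℝ}
    (hx : x ∈ Icc (0 : ℝ) 1) (hy : y ∈ Icc (0 : ℝ) 1) :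
    HasDerivWithinAt (fun t => g (x, t)) (partialY g (x, y)) (Icc 0 1) y := by
  rw [partialY_eq_fderivWithin hg ⟨hx, hy⟩]
  exact hasDerivWithinAt_fderivY (p := (x, y)) hg ⟨hx, hy⟩

theorem contDiffOn_partialX {m n : WithTop ℕ∞} (hg : ContDiffOn ℝ n g closedSquare)
    (hmn : m + 1 ≤ n) : ContDiffOn ℝ m (partialX g) closedSquare :=
  ((hg.fderivWithin uniqueDiffOn_closedSquare hmn).clm_apply contDiffOn_const).congr
    fun _ hp => partialX_eq_fderivWithin (hg.of_le (le_add_self.trans hmn)) hp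

theorem contDiffOn_partialY {m n : WithTop ℕ∞} (hg : ContDiffOn ℝ n g closedSquare)
    (hmn : m + 1 ≤ n) : ContDiffOn ℝ m (partialY g) closedSquare :=
  ((hg.fderivWithin uniqueDiffOn_closedSquare hmn).clm_apply contDiffOn_const).congr
    fun _ hp => partialY_eq_fderivWithin (hg.of_le (le_add_self.trans hmn)) hp

theorem partialX_congr {g' : ℝ × ℝ → ℝ} (h : EqOn g g' closedSquare) :
    EqOn (partialX g) (partialX g') closedSquare := fun _ hp =>
  derivWithin_congr (fun _ hs => h ⟨hs, hp.2⟩) (h hp)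

theorem partialY_congr {g' : ℝ × ℝ → ℝ} (h : EqOn g g' closedSquare) :
    EqOn (partialY g) (partialY g') closedSquare := fun _ hp =>
  derivWithin_congr (fun _ hs => h ⟨hp.1, hs⟩) (h hp)

/-- Mixed second partial derivatives agree up to the boundary of the square. -/
theorem partialX_partialY_comm (hg : ContDiffOn ℝ 2 g closedSquare) :
    EqOn (partialX (partialY g)) (partialY (partialX g)) closedSquare := by
  intro p hp
  have h1 : ContDiffOn ℝ 1 g closedSquare := hg.of_le (by norm_num)
  have hx1 : ContDiffOn ℝ 1 (partialX g) closedSquare := contDiffOn_partialX hg (by norm_num)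
  have hy1 : ContDiffOn ℝ 1 (partialY g) closedSquare := contDiffOn_partialY hg (by norm_num)
  have hud := uniqueDiffOn_closedSquare p hp
  have hD : DifferentiableWithinAt ℝ (fderivWithin ℝ g closedSquare) closedSquare p :=
    ((hg.fderivWithin (m := 1) uniqueDiffOn_closedSquare (by norm_num)).differentiableOn
      one_ne_zero) p hp
  have key (v w : ℝ × ℝ) :
      fderivWithin ℝ (fun q => fderivWithin ℝ g closedSquare q v) closedSquare p w
        = fderivWithin ℝ (fderivWithin ℝ g closedSquare) closedSquare p w v := by
    rw [fderivWithin_clm_apply hud hD (differentiableWithinAt_const _)]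
    simp
  have hsymm : IsSymmSndFDerivWithinAt ℝ g closedSquare p :=
    (hg p hp).isSymmSndFDerivWithinAt (by simp) uniqueDiffOn_closedSquare
      (by rw [interior_closedSquare, closure_openSquare]; exact hp) hp
  rw [partialX_eq_fderivWithin hy1 hp, partialY_eq_fderivWithin hx1 hp,
    fderivWithin_congr (fun q hq => partialY_eq_fderivWithin h1 hq)
      (partialY_eq_fderivWithin h1 hp),
    fderivWithin_congr (fun q hq => partialX_eq_fderivWithin h1 hq)
      (partialX_eq_fderivWithin h1 hp), key, key]
  exact hsymm _ _

theorem partialX_neg_add {g₁ g₂ : ℝ × ℝ → ℝ} (h₁ : ContDiffOn ℝ 1 g₁ closedSquare)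
    (h₂ : ContDiffOn ℝ 1 g₂ closedSquare) :
    EqOn (partialX fun q => -(g₁ q + g₂ q)) (fun q => -(partialX g₁ q + partialX g₂ q))
      closedSquare := fun _ hp =>
  (((hasDerivWithinAt_partialX h₁ hp.1 hp.2).add
    (hasDerivWithinAt_partialX h₂ hp.1 hp.2)).neg).derivWithin
      (uniqueDiffOn_Icc zero_lt_one _ hp.1)

/-- Gauss' theorem on a rectangle, for the gradient field of `g`. -/
theorem integral_laplacian_rectangle (hg : ContDiffOn ℝ 2 g closedSquare) {a b c d : ℝ}
    (ha : 0 ≤ a) (hab : a ≤ b) (hb : b ≤ 1) (hc : 0 ≤ c) (hcd : c ≤ d) (hd : d ≤ 1) :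
    ∫ p in Icc a b ×ˢ Icc c d, (partialX (partialX g) p + partialY (partialY g) p)
      = ((∫ t in c..d, partialX g (b, t)) - ∫ t in c..d, partialX g (a, t))
        + ((∫ s in a..b, partialY g (s, d)) - ∫ s in a..b, partialY g (s, c)) := by
  have hx : ContDiffOn ℝ 1 (partialX g) closedSquare := contDiffOn_partialX hg (by norm_num)
  have hy : ContDiffOn ℝ 1 (partialY g) closedSquare := contDiffOn_partialY hg (by norm_num)
  have hsub : Icc (a, c) (b, d) ⊆ closedSquare := by
    rw [closedSquare_eq_Icc]
    exact Icc_subset_Icc ⟨ha, hc⟩ ⟨hb, hd⟩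
  have hint : interior (Icc (a, c) (b, d)) ⊆ interior closedSquare := interior_mono hsub
  have hD {q : ℝ × ℝ → ℝ} (hq : ContDiffOn ℝ 1 q closedSquare) (p : ℝ × ℝ)
      (hp : p ∈ Ioo a b ×ˢ Ioo c d) :
      HasFDerivAt q (fderivWithin ℝ q closedSquare p) p := by
    have hp' : p ∈ interior closedSquare := by
      apply hint
      rw [← Icc_prod_Icc, interior_prod_eq, interior_Icc, interior_Icc]
      exact hp
    exact ((hq.differentiableOn one_ne_zero) p (interior_subset hp')).hasFDerivWithinAt.hasFDerivAt
      (mem_interior_iff_mem_nhds.mp hp')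
  have hcont {q : ℝ × ℝ → ℝ} (hq : ContDiffOn ℝ 1 q closedSquare) (v : ℝ × ℝ) :
      ContinuousOn (fun p => fderivWithin ℝ q closedSquare p v) (Icc (a, c) (b, d)) :=
    (((hq.continuousOn_fderivWithin uniqueDiffOn_closedSquare le_rfl).clm_apply
      continuousOn_const)).mono hsub
  have h := integral_divergence_prod_Icc_of_hasFDerivAt_of_le (partialX g) (partialY g)
    (fderivWithin ℝ (partialX g) closedSquare) (fderivWithin ℝ (partialY g) closedSquare)
    (a, c) (b, d) ⟨hab, hcd⟩ (hx.continuousOn.mono hsub) (hy.continuousOn.mono hsub)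
    (hD hx) (hD hy) (((hcont hx _).add (hcont hy _)).integrableOn_compact isCompact_Icc)
  rw [Icc_prod_Icc]
  rw [setIntegral_congr_fun (g := fun p => fderivWithin ℝ (partialX g) closedSquare p (1, 0)
    + fderivWithin ℝ (partialY g) closedSquare p (0, 1)) measurableSet_Icc, h]
  · ring
  · intro p hp
    simp only
    rw [partialX_eq_fderivWithin hx (hsub hp), partialY_eq_fderivWithin hy (hsub hp)]

end Slices

theorem contDiffOn_iterate_partialX {g : ℝ × ℝ → ℝ} {m : ℕ} (a : ℕ)
    (hg : ContDiffOn ℝ (m + a : ℕ) g closedSquare) :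
    ContDiffOn ℝ m (partialX^[a] g) closedSquare := by
  induction a generalizing g with
  | zero => exact hg
  | succ a ih =>
    exact ih (contDiffOn_partialX hg (by norm_cast))

theorem contDiffOn_iterate_partialY {g : ℝ × ℝ → ℝ} {m : ℕ} (b : ℕ)
    (hg : ContDiffOn ℝ (m + b : ℕ) g closedSquare) :
    ContDiffOn ℝ m (partialY^[b] g) closedSquare := by
  induction b generalizing g with
  | zero => exact hg
  | succ b ih =>
    exact ih (contDiffOn_partialY hg (by norm_cast))

/-- The supremum in `cNorm` is over a bounded set, hence bounds every derivative. -/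
theorem abs_partialD_le_cNorm {u : ℝ × ℝ → ℝ} {m : ℕ} (hu : ContDiffOn ℝ m u closedSquare)
    {a b : ℕ} (hab : a + b ≤ m) {p : ℝ × ℝ} (hp : p ∈ closedSquare) :
    |partialD a b u p| ≤ cNorm m u := by
  have hex : ∀ a b : ℕ, ∃ C : ℝ, a + b ≤ m → ∀ q ∈ closedSquare, |partialD a b u q| ≤ C := by
    intro a b
    by_cases h : a + b ≤ m
    · have hc : ContinuousOn (partialD a b u) closedSquare :=
        (contDiffOn_iterate_partialX (m := 0) a (contDiffOn_iterate_partialY (m := 0 + a) b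
          (hu.of_le (by norm_cast; omega)))).continuousOn
      obtain ⟨C, hC⟩ := isCompact_closedSquare.exists_bound_of_continuousOn hc
      exact ⟨C, fun _ => hC⟩
    · exact ⟨0, fun h' => absurd h' h⟩
  choose C hC using hex
  refine le_csSup ⟨∑ a ∈ Finset.range (m + 1), ∑ b ∈ Finset.range (m + 1), |C a b|, ?_⟩
    ⟨a, b, hab, p, hp, rfl⟩
  rintro r ⟨a, b, h, q, hq, rfl⟩
  calc |partialD a b u q| ≤ |C a b| := (hC a b h q hq).trans (le_abs_self _)
    _ ≤ ∑ b ∈ Finset.range (m + 1), |C a b| :=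
      Finset.single_le_sum (f := fun b => |C a b|) (fun _ _ => abs_nonneg _)
        (Finset.mem_range.mpr (by omega))
    _ ≤ _ := Finset.single_le_sum (f := fun a => ∑ b ∈ Finset.range (m + 1), |C a b|)
        (fun _ _ => Finset.sum_nonneg fun _ _ => abs_nonneg _) (Finset.mem_range.mpr (by omega))

/-! ### One-dimensional Taylor estimates -/

section Taylor

variable {φ φ₁ φ₂ φ₃ : ℝ → ℝ} {a b K U : ℝ}

/-- The increment of a function whose derivative is within `K` of the constant `c`. -/
theorem abs_sub_sub_mul_le (hφ : ∀ s ∈ Icc (0 : ℝ) 1, HasDerivWithinAt φ (φ₁ s) (Icc 0 1) s)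
    (ha : a ∈ Icc (0 : ℝ) 1) (hb : b ∈ Icc (0 : ℝ) 1) {c : ℝ}
    (hK : ∀ s ∈ uIcc a b, |φ₁ s - c| ≤ K) :
    |φ b - φ a - c * (b - a)| ≤ K * |b - a| := by
  have hsub : uIcc a b ⊆ Icc 0 1 := ordConnected_Icc.uIcc_subset ha hb
  have h := (convex_uIcc a b).norm_image_sub_le_of_norm_hasDerivWithin_le
    (f := fun s => φ s - c * s) (f' := fun s => φ₁ s - c * 1) (C := K)
    (fun s hs => ((hφ s (hsub hs)).mono hsub).sub ((hasDerivWithinAt_id s _).const_mul c))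
    (fun s hs => by simpa using hK s hs) left_mem_uIcc right_mem_uIcc
  simp only [Real.norm_eq_abs] at h
  convert h using 2
  ring

theorem abs_sub_le_of_deriv (hφ : ∀ s ∈ Icc (0 : ℝ) 1, HasDerivWithinAt φ (φ₁ s) (Icc 0 1) s)
    (hU : ∀ s ∈ Icc (0 : ℝ) 1, |φ₁ s| ≤ U) (ha : a ∈ Icc (0 : ℝ) 1) (hb : b ∈ Icc (0 : ℝ) 1) :
    |φ b - φ a| ≤ U * |b - a| := by
  simpa using abs_sub_sub_mul_le hφ ha hb (c := 0) (K := U)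
    (fun s hs => by simpa using hU s (ordConnected_Icc.uIcc_subset ha hb hs))

theorem abs_taylor_one_le (hφ : ∀ s ∈ Icc (0 : ℝ) 1, HasDerivWithinAt φ (φ₁ s) (Icc 0 1) s)
    (hφ₁ : ∀ s ∈ Icc (0 : ℝ) 1, HasDerivWithinAt φ₁ (φ₂ s) (Icc 0 1) s)
    (hU : ∀ s ∈ Icc (0 : ℝ) 1, |φ₂ s| ≤ U) (ha : a ∈ Icc (0 : ℝ) 1) (hb : b ∈ Icc (0 : ℝ) 1) :
    |φ b - φ a - φ₁ a * (b - a)| ≤ U * |b - a| ^ 2 := by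
  have hU0 : 0 ≤ U := (abs_nonneg _).trans (hU a ha)
  -- The constant is not the sharp one; only the order in `|b - a|` matters.
  have := abs_sub_sub_mul_le hφ ha hb (c := φ₁ a) (K := U * |b - a|) fun s hs =>
    (abs_sub_le_of_deriv hφ₁ hU ha (ordConnected_Icc.uIcc_subset ha hb hs)).trans
      (mul_le_mul_of_nonneg_left (abs_sub_left_of_mem_uIcc hs) hU0)
  calc _ ≤ _ := this
    _ = _ := by ring

theorem abs_taylor_two_le (hφ : ∀ s ∈ Icc (0 : ℝ) 1, HasDerivWithinAt φ (φ₁ s) (Icc 0 1) s)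
    (hφ₁ : ∀ s ∈ Icc (0 : ℝ) 1, HasDerivWithinAt φ₁ (φ₂ s) (Icc 0 1) s)
    (hφ₂ : ∀ s ∈ Icc (0 : ℝ) 1, HasDerivWithinAt φ₂ (φ₃ s) (Icc 0 1) s)
    (hU : ∀ s ∈ Icc (0 : ℝ) 1, |φ₃ s| ≤ U) (ha : a ∈ Icc (0 : ℝ) 1) (hb : b ∈ Icc (0 : ℝ) 1) :
    |φ b - φ a - φ₁ a * (b - a) - φ₂ a * (b - a) ^ 2 / 2| ≤ U * |b - a| ^ 3 := by
  have hU0 : 0 ≤ U := (abs_nonneg _).trans (hU a ha)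
  have := abs_sub_sub_mul_le (φ := fun s => φ s - φ₂ a * (s - a) ^ 2 / 2)
    (φ₁ := fun s => φ₁ s - φ₂ a * (s - a)) (a := a) (b := b) (c := φ₁ a)
    (K := U * |b - a| ^ 2)
    (fun s hs => by
      refine (hφ s hs).sub ?_
      have hid := (hasDerivAt_id' s).hasDerivWithinAt (s := Icc (0 : ℝ) 1)
      have h := (((hid.sub_const a).fun_pow 2).const_mul (φ₂ a)).div_const 2
      exact h.congr_deriv (by push_cast; ring))
    ha hb fun s hs => by
      have h1 := abs_taylor_one_le hφ₁ hφ₂ hU ha (ordConnected_Icc.uIcc_subset ha hb hs)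
      have h2 : |s - a| ≤ |b - a| := abs_sub_left_of_mem_uIcc hs
      calc |φ₁ s - φ₂ a * (s - a) - φ₁ a| = |φ₁ s - φ₁ a - φ₂ a * (s - a)| := by ring_nf
        _ ≤ U * |s - a| ^ 2 := h1
        _ ≤ U * |b - a| ^ 2 := by gcongr
  calc _ = |φ b - φ₂ a * (b - a) ^ 2 / 2 - (φ a - φ₂ a * (a - a) ^ 2 / 2) - φ₁ a * (b - a)| := by
        ring_nf
    _ ≤ _ := this
    _ = _ := by ring

/-- A difference quotient is within `K` of `c` if the derivative is. -/
theorem abs_div_sub_le (hφ : ∀ s ∈ Icc (0 : ℝ) 1, HasDerivWithinAt φ (φ₁ s) (Icc 0 1) s)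
    (ha : a ∈ Icc (0 : ℝ) 1) (hb : b ∈ Icc (0 : ℝ) 1) (hab : a < b) {c : ℝ}
    (hK : ∀ s ∈ Icc a b, |φ₁ s - c| ≤ K) :
    |(φ b - φ a) / (b - a) - c| ≤ K := by
  have h := abs_sub_sub_mul_le hφ ha hb (c := c) (K := K) (by rwa [uIcc_of_le hab.le])
  have hpos : 0 < b - a := sub_pos.mpr hab
  rw [abs_of_pos hpos] at h
  rw [show (φ b - φ a) / (b - a) - c = (φ b - φ a - c * (b - a)) / (b - a) by field_simp,
    abs_div, abs_of_pos hpos, div_le_iff₀ hpos]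
  exact h

/-- The difference quotient between two points on either side of `m` agrees to second order with
the first derivative at `m` plus the offset of the midpoint times the second derivative. -/
theorem abs_div_sub_second_order_le
    (hφ : ∀ s ∈ Icc (0 : ℝ) 1, HasDerivWithinAt φ (φ₁ s) (Icc 0 1) s)
    (hφ₁ : ∀ s ∈ Icc (0 : ℝ) 1, HasDerivWithinAt φ₁ (φ₂ s) (Icc 0 1) s)
    (hφ₂ : ∀ s ∈ Icc (0 : ℝ) 1, HasDerivWithinAt φ₂ (φ₃ s) (Icc 0 1) s)
    (hU : ∀ s ∈ Icc (0 : ℝ) 1, |φ₃ s| ≤ U) {m h : ℝ}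
    (ha : a ∈ Icc (0 : ℝ) 1) (hm : m ∈ Icc (0 : ℝ) 1) (hb : b ∈ Icc (0 : ℝ) 1)
    (ham : a ≤ m) (hmb : m ≤ b) (hab : a < b) (h1 : m - a ≤ h) (h2 : b - m ≤ h) :
    |(φ b - φ a) / (b - a) - φ₁ m - ((b - m) - (m - a)) / 2 * φ₂ m| ≤ U * h ^ 2 := by
  have hU0 : 0 ≤ U := (abs_nonneg _).trans (hU a ha)
  have hpos : 0 < b - a := sub_pos.mpr hab
  have hB := abs_taylor_two_le hφ hφ₁ hφ₂ hU hm hb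
  have hA := abs_taylor_two_le hφ hφ₁ hφ₂ hU hm ha
  rw [abs_of_nonneg (sub_nonneg.mpr hmb)] at hB
  rw [abs_of_nonpos (sub_nonpos.mpr ham)] at hA
  have hkey : (φ b - φ a) / (b - a) - φ₁ m - ((b - m) - (m - a)) / 2 * φ₂ m
      = ((φ b - φ m - φ₁ m * (b - m) - φ₂ m * (b - m) ^ 2 / 2)
        - (φ a - φ m - φ₁ m * (a - m) - φ₂ m * (a - m) ^ 2 / 2)) / (b - a) := by
    field_simp
    ring
  rw [hkey, abs_div, abs_of_pos hpos, div_le_iff₀ hpos]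
  have hB' : U * (b - m) ^ 3 ≤ U * (h ^ 2 * (b - m)) := by
    rw [pow_succ]; gcongr
  have hA' : U * (-(a - m)) ^ 3 ≤ U * (h ^ 2 * (-(a - m))) := by
    rw [pow_succ]; gcongr <;> linarith
  calc _ ≤ _ := abs_sub _ _
    _ ≤ U * (h ^ 2 * (b - m)) + U * (h ^ 2 * (-(a - m))) := add_le_add (hB.trans hB') (hA.trans hA')
    _ = _ := by ring

theorem abs_integral_sub_const_le {ψ : ℝ → ℝ} (hψ : IntervalIntegrable ψ volume a b)
    (hab : a ≤ b) {c : ℝ} (hK : ∀ t ∈ Icc a b, |ψ t - c| ≤ K) :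
    |(∫ t in a..b, ψ t) - (b - a) * c| ≤ (b - a) * K := by
  have h := intervalIntegral.norm_integral_le_of_norm_le_const (a := a) (b := b)
    (f := fun t => ψ t - c) (C := K)
    (fun t ht => hK t (by rw [uIoc_of_le hab] at ht; exact Ioc_subset_Icc_self ht))
  rw [intervalIntegral.integral_sub hψ intervalIntegrable_const, intervalIntegral.integral_const,
    smul_eq_mul, Real.norm_eq_abs, abs_of_nonneg (sub_nonneg.mpr hab)] at h
  linarith

/-- One-point quadrature with the first moment correction. -/
theorem abs_integral_sub_first_moment_le
    (hφ : ∀ s ∈ Icc (0 : ℝ) 1, HasDerivWithinAt φ (φ₁ s) (Icc 0 1) s)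
    (hφ₁ : ∀ s ∈ Icc (0 : ℝ) 1, HasDerivWithinAt φ₁ (φ₂ s) (Icc 0 1) s)
    (hU : ∀ s ∈ Icc (0 : ℝ) 1, |φ₂ s| ≤ U) {m h : ℝ}
    (ha : a ∈ Icc (0 : ℝ) 1) (hm : m ∈ Icc (0 : ℝ) 1) (hb : b ∈ Icc (0 : ℝ) 1)
    (ham : a ≤ m) (hmb : m ≤ b) (h1 : m - a ≤ h) (h2 : b - m ≤ h) :
    |(∫ t in a..b, φ t) - (b - a) * φ m - ((b - m) ^ 2 - (m - a) ^ 2) / 2 * φ₁ m|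
      ≤ (b - a) * (U * h ^ 2) := by
  have hU0 : 0 ≤ U := (abs_nonneg _).trans (hU a ha)
  have hab : a ≤ b := ham.trans hmb
  have hsub : uIcc a b ⊆ Icc 0 1 := ordConnected_Icc.uIcc_subset ha hb
  have hint : IntervalIntegrable φ volume a b :=
    ContinuousOn.intervalIntegrable fun s hs =>
      ((hφ s (hsub hs)).continuousWithinAt).mono hsub
  have hlin : IntervalIntegrable (fun t => φ₁ m * (t - m)) volume a b :=
    Continuous.intervalIntegrable (by fun_prop) _ _
  have hval : ∫ t in a..b, φ₁ m * (t - m) = ((b - m) ^ 2 - (m - a) ^ 2) / 2 * φ₁ m := by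
    rw [intervalIntegral.integral_const_mul, intervalIntegral.integral_sub
      intervalIntegral.intervalIntegrable_id intervalIntegrable_const, integral_id,
      intervalIntegral.integral_const, smul_eq_mul]
    ring
  have h := abs_integral_sub_const_le (hint.sub hlin) hab (c := φ m) (K := U * h ^ 2) fun t ht => by
    have ht' : t ∈ Icc (0 : ℝ) 1 := ⟨ha.1.trans ht.1, ht.2.trans hb.2⟩
    have htm : |t - m| ≤ h := abs_le.mpr ⟨by linarith [ht.1], by linarith [ht.2]⟩
    calc |φ t - φ₁ m * (t - m) - φ m| = |φ t - φ m - φ₁ m * (t - m)| := by ring_nf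
      _ ≤ U * |t - m| ^ 2 := abs_taylor_one_le hφ hφ₁ hU hm ht'
      _ ≤ _ := by gcongr
  rw [intervalIntegral.integral_sub hint hlin, hval] at h
  convert h using 2
  ring

end Taylor

/-! ### Geometry of a partition -/

namespace Partition

variable (P : Partition) {i : ℕ}

theorem face_eq_sum {m : ℕ} (hm : m ≤ P.n) : P.face m = ∑ i ∈ Finset.range m, P.width (i + 1) := by
  induction m with
  | zero => simp [P.face_zero]
  | succ m ih =>
    rw [P.face_step (m + 1) (Finset.mem_Icc.mpr ⟨by omega, hm⟩), Nat.add_sub_cancel,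
      ih (by omega), Finset.sum_range_succ]

theorem sum_width_range : ∑ i ∈ Finset.range (P.n + 1), P.width i = 1 := by
  rw [Finset.sum_range_succ', P.width_zero, add_zero, ← P.sum_width,
    Finset.range_eq_Ico, Finset.sum_Ico_add' P.width 0 P.n 1]
  rfl

theorem face_last : P.face P.n = 1 := by
  rw [P.face_eq_sum le_rfl, ← P.sum_width_range, Finset.sum_range_succ', P.width_zero, add_zero]

theorem width_nonneg (hi : i ≤ P.n) : 0 ≤ P.width i := by
  rcases Nat.eq_zero_or_pos i with rfl | h
  · exact P.width_zero.ge
  · exact (P.width_pos i (Finset.mem_Icc.mpr ⟨h, hi⟩)).le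

theorem face_mono {m k : ℕ} (hmk : m ≤ k) (hk : k ≤ P.n) : P.face m ≤ P.face k := by
  rw [P.face_eq_sum hk, P.face_eq_sum (hmk.trans hk)]
  refine Finset.sum_le_sum_of_subset_of_nonneg (Finset.range_mono hmk) fun i hi _ => ?_
  exact P.width_nonneg (by have := Finset.mem_range.mp hi; omega)

theorem face_mem (hi : i ≤ P.n) : P.face i ∈ Icc (0 : ℝ) 1 :=
  ⟨P.face_zero ▸ P.face_mono (Nat.zero_le i) hi, P.face_last ▸ P.face_mono hi le_rfl⟩

theorem plus_pos (h0 : 1 ≤ i) (hi : i ≤ P.n) : 0 < P.plus i :=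
  sub_pos.mpr (P.node_mem i (Finset.mem_Icc.mpr ⟨h0, hi⟩)).2

theorem minus_pos (h0 : 1 ≤ i) (hi : i ≤ P.n) : 0 < P.minus i :=
  sub_pos.mpr (P.node_mem i (Finset.mem_Icc.mpr ⟨h0, hi⟩)).1

theorem plus_nonneg (hi : i ≤ P.n) : 0 ≤ P.plus i := by
  rcases Nat.eq_zero_or_pos i with rfl | h
  · exact P.plus_zero.ge
  · exact (P.plus_pos h hi).le

theorem minus_succ_nonneg (hi : i ≤ P.n) : 0 ≤ P.minus (i + 1) := by
  rcases hi.eq_or_lt with rfl | h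
  · exact P.minus_last.ge
  · exact (P.minus_pos (by omega) h).le

theorem half_eq (i : ℕ) : P.half i = P.plus i + P.minus (i + 1) := by
  simp [half, plus, minus]

theorem half_pos (hi : i ≤ P.n) : 0 < P.half i := by
  rw [half_eq]
  rcases Nat.eq_zero_or_pos i with rfl | h
  · rw [P.plus_zero, zero_add]
    exact P.minus_pos le_rfl P.n_pos
  · exact add_pos_of_pos_of_nonneg (P.plus_pos h hi) (P.minus_succ_nonneg hi)

theorem minus_add_plus (h0 : 1 ≤ i) (hi : i ≤ P.n) : P.minus i + P.plus i = P.width i := by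
  simp [minus, plus, P.face_step i (Finset.mem_Icc.mpr ⟨h0, hi⟩)]

theorem width_le_size (h0 : 1 ≤ i) (hi : i ≤ P.n) : P.width i ≤ P.size :=
  Finset.le_sup' P.width (Finset.mem_Icc.mpr ⟨h0, hi⟩)

theorem size_pos : 0 < P.size :=
  (P.width_pos 1 (Finset.mem_Icc.mpr ⟨le_rfl, P.n_pos⟩)).trans_le (P.width_le_size le_rfl P.n_pos)

theorem plus_le_size (hi : i ≤ P.n) : P.plus i ≤ P.size := by
  rcases Nat.eq_zero_or_pos i with rfl | h
  · exact P.plus_zero.le.trans P.size_pos.le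
  · linarith [P.minus_add_plus h hi, P.minus_pos h hi, P.width_le_size h hi]

theorem minus_succ_le_size (hi : i ≤ P.n) : P.minus (i + 1) ≤ P.size := by
  rcases hi.eq_or_lt with rfl | h
  · exact P.minus_last.le.trans P.size_pos.le
  · linarith [P.minus_add_plus (i := i + 1) (by omega) h, P.plus_pos (i := i + 1) (by omega) h,
      P.width_le_size (i := i + 1) (by omega) h]

theorem node_le_face (hi : i ≤ P.n) : P.node i ≤ P.face i := sub_nonneg.mp (P.plus_nonneg hi)

theorem face_le_node_succ (hi : i ≤ P.n) : P.face i ≤ P.node (i + 1) := by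
  have := P.minus_succ_nonneg hi
  simpa [minus] using this

theorem node_lt_node_succ (hi : i ≤ P.n) : P.node i < P.node (i + 1) :=
  sub_pos.mp (P.half_pos hi)

theorem node_mem_Icc (hi : i ≤ P.n + 1) : P.node i ∈ Icc (0 : ℝ) 1 := by
  constructor
  · rcases Nat.eq_zero_or_pos i with rfl | h
    · exact P.node_zero.ge
    · obtain ⟨m, rfl⟩ := Nat.exists_eq_succ_of_ne_zero h.ne'
      exact (P.face_mem (by omega)).1.trans (P.face_le_node_succ (by omega))
  · rcases hi.eq_or_lt with rfl | h
    · exact P.node_last.le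
    · exact (P.node_le_face (by omega)).trans (P.face_mem (by omega)).2

theorem sum_half (m : ℕ) : ∑ i ∈ Finset.range m, P.half i = P.node m := by
  simp only [half]
  rw [Finset.sum_range_sub, P.node_zero, sub_zero]

/-- Discrete Poincaré inequality in pointwise form, by Cauchy–Schwarz. -/
theorem sq_le_sum_sq_div {g : ℕ → ℝ} (h0 : g 0 = 0) (hi : i ≤ P.n + 1) :
    g i ^ 2 ≤ ∑ m ∈ Finset.range (P.n + 1), (g (m + 1) - g m) ^ 2 / P.half m := by
  have hpos : ∀ m ∈ Finset.range (P.n + 1), 0 < P.half m := fun m hm =>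
    P.half_pos (by have := Finset.mem_range.mp hm; omega)
  have hsub : Finset.range i ⊆ Finset.range (P.n + 1) := Finset.range_mono hi
  have hcs := Finset.sum_sq_le_sum_mul_sum_of_sq_le_mul (Finset.range i)
    (r := fun m => g (m + 1) - g m) (f := P.half) (g := fun m => (g (m + 1) - g m) ^ 2 / P.half m)
    (fun m hm => (hpos m (hsub hm)).le)
    (fun m hm => div_nonneg (sq_nonneg _) (hpos m (hsub hm)).le)
    (fun m hm => by rw [mul_div_cancel₀ _ (hpos m (hsub hm)).ne'])
  rw [Finset.sum_range_sub, h0, sub_zero, P.sum_half] at hcs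
  have hle : ∑ m ∈ Finset.range i, (g (m + 1) - g m) ^ 2 / P.half m
      ≤ ∑ m ∈ Finset.range (P.n + 1), (g (m + 1) - g m) ^ 2 / P.half m :=
    Finset.sum_le_sum_of_subset_of_nonneg hsub fun m hm _ =>
      div_nonneg (sq_nonneg _) (hpos m hm).le
  have hnn : 0 ≤ ∑ m ∈ Finset.range i, (g (m + 1) - g m) ^ 2 / P.half m :=
    Finset.sum_nonneg fun m hm => div_nonneg (sq_nonneg _) (hpos m (hsub hm)).le
  calc g i ^ 2 ≤ _ := hcs
    _ ≤ 1 * _ := mul_le_mul_of_nonneg_right (P.node_mem_Icc hi).2 hnn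
    _ ≤ _ := by rwa [one_mul]

/-- Discrete Poincaré inequality, for a weighted family of functions vanishing at the left end
point. -/
theorem sum_mul_sq_le {α κ : ℕ → ℝ} {w : ℕ → ℕ → ℝ} {t : Finset ℕ}
    (hα : ∀ i ∈ Finset.range (P.n + 1), 0 ≤ α i) (hα1 : ∑ i ∈ Finset.range (P.n + 1), α i = 1)
    (hκ : ∀ j ∈ t, 0 ≤ κ j) (h0 : ∀ j ∈ t, w 0 j = 0) :
    ∑ i ∈ Finset.range (P.n + 1), ∑ j ∈ t, α i * κ j * w i j ^ 2
      ≤ ∑ i ∈ Finset.range (P.n + 1), ∑ j ∈ t, κ j * ((w (i + 1) j - w i j) ^ 2 / P.half i) := by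
  rw [Finset.sum_comm, Finset.sum_comm (s := Finset.range (P.n + 1)) (t := t)]
  refine Finset.sum_le_sum fun j hj => ?_
  rw [← Finset.mul_sum]
  calc _ ≤ ∑ i ∈ Finset.range (P.n + 1), α i * (κ j *
        ∑ m ∈ Finset.range (P.n + 1), (w (m + 1) j - w m j) ^ 2 / P.half m) := by
        refine Finset.sum_le_sum fun i hi => ?_
        rw [mul_assoc]
        refine mul_le_mul_of_nonneg_left (mul_le_mul_of_nonneg_left ?_ (hκ j hj)) (hα i hi)
        exact P.sq_le_sum_sq_div (g := fun i => w i j) (h0 j hj)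
          (by have := Finset.mem_range.mp hi; omega)
    _ = _ := by rw [← Finset.sum_mul, hα1, one_mul]

end Partition

/-! ### Sums over the mesh -/

theorem sum_range_succ_sub_mul (F e : ℕ → ℝ) (n : ℕ) (h0 : e 0 = 0) (hn : e (n + 1) = 0) :
    ∑ i ∈ Finset.range n, (F (i + 1) - F i) * e (i + 1)
      = -∑ i ∈ Finset.range (n + 1), F i * (e (i + 1) - e i) := by
  have key : ∀ m, ∑ i ∈ Finset.range m, (F (i + 1) - F i) * e (i + 1)
      = F m * e (m + 1) - ∑ i ∈ Finset.range (m + 1), F i * (e (i + 1) - e i) := by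
    intro m
    induction m with
    | zero => simp [h0]
    | succ m ih => rw [Finset.sum_range_succ, ih, Finset.sum_range_succ _ (m + 1)]; ring
  rw [key, hn, mul_zero, zero_sub]

section Shift

variable {q : ℕ → ℕ → ℝ} {m n : ℕ}

theorem sum_shift_le {r : ℕ → ℝ} (h : ∀ i ≤ n, 0 ≤ r i) :
    ∑ i ∈ Finset.range n, r (i + 1) ≤ ∑ i ∈ Finset.range (n + 1), r i := by
  rw [Finset.sum_range_succ']
  linarith [h 0 (Nat.zero_le n)]

theorem sum_init_le {r : ℕ → ℝ} (h : ∀ i ≤ n, 0 ≤ r i) :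
    ∑ i ∈ Finset.range n, r i ≤ ∑ i ∈ Finset.range (n + 1), r i := by
  rw [Finset.sum_range_succ]
  linarith [h n le_rfl]

theorem sum_shift_shift_le (h : ∀ i ≤ m, ∀ j ≤ n, 0 ≤ q i j) :
    ∑ i ∈ Finset.range m, ∑ j ∈ Finset.range n, q (i + 1) (j + 1)
      ≤ ∑ i ∈ Finset.range (m + 1), ∑ j ∈ Finset.range (n + 1), q i j :=
  (Finset.sum_le_sum fun i hi => sum_shift_le (r := q (i + 1))
    (h (i + 1) (by have := Finset.mem_range.mp hi; omega))).trans
    (sum_shift_le (r := fun i => ∑ j ∈ Finset.range (n + 1), q i j) fun i hi =>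
      Finset.sum_nonneg fun j hj => h i hi j (by have := Finset.mem_range.mp hj; omega))

theorem sum_shift_init_le (h : ∀ i ≤ m, ∀ j ≤ n, 0 ≤ q i j) :
    ∑ i ∈ Finset.range m, ∑ j ∈ Finset.range n, q (i + 1) j
      ≤ ∑ i ∈ Finset.range (m + 1), ∑ j ∈ Finset.range (n + 1), q i j :=
  (Finset.sum_le_sum fun i hi => sum_init_le (r := q (i + 1))
    (h (i + 1) (by have := Finset.mem_range.mp hi; omega))).trans
    (sum_shift_le (r := fun i => ∑ j ∈ Finset.range (n + 1), q i j) fun i hi =>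
      Finset.sum_nonneg fun j hj => h i hi j (by have := Finset.mem_range.mp hj; omega))

theorem sum_init_shift_le (h : ∀ i ≤ m, ∀ j ≤ n, 0 ≤ q i j) :
    ∑ i ∈ Finset.range m, ∑ j ∈ Finset.range n, q i (j + 1)
      ≤ ∑ i ∈ Finset.range (m + 1), ∑ j ∈ Finset.range (n + 1), q i j :=
  (Finset.sum_le_sum fun i hi => sum_shift_le (r := q i)
    (h i (by have := Finset.mem_range.mp hi; omega))).trans
    (sum_init_le (r := fun i => ∑ j ∈ Finset.range (n + 1), q i j) fun i hi =>
      Finset.sum_nonneg fun j hj => h i hi j (by have := Finset.mem_range.mp hj; omega))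

end Shift

namespace Mesh

variable (τ : Mesh)

/-- The part of the squared discrete `H^1_0` norm due to differences in `x`. -/
noncomputable def energyX (w : ℕ → ℕ → ℝ) : ℝ :=
  ∑ i ∈ Finset.range (τ.X.n + 1), ∑ j ∈ Finset.range (τ.Y.n + 1),
    τ.Y.width j * ((w (i + 1) j - w i j) ^ 2 / τ.X.half i)

/-- The part of the squared discrete `H^1_0` norm due to differences in `y`. -/
noncomputable def energyY (w : ℕ → ℕ → ℝ) : ℝ :=
  ∑ i ∈ Finset.range (τ.X.n + 1), ∑ j ∈ Finset.range (τ.Y.n + 1),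
    τ.X.width i * ((w i (j + 1) - w i j) ^ 2 / τ.Y.half j)

/-- A discrete function vanishes at the boundary indices. -/
def VanishesOnBoundary (w : ℕ → ℕ → ℝ) : Prop :=
  (∀ j ≤ τ.Y.n + 1, w 0 j = 0 ∧ w (τ.X.n + 1) j = 0) ∧
    ∀ i ≤ τ.X.n + 1, w i 0 = 0 ∧ w i (τ.Y.n + 1) = 0

theorem size_pos : 0 < τ.size := τ.X.size_pos.trans_le (le_max_left _ _)

variable {τ} {w z e F G D : ℕ → ℕ → ℝ}

theorem energyX_term_nonneg {i j : ℕ} (hi : i ≤ τ.X.n) (hj : j ≤ τ.Y.n) (t : ℝ) :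
    0 ≤ τ.Y.width j * (t ^ 2 / τ.X.half i) :=
  mul_nonneg (τ.Y.width_nonneg hj) (div_nonneg (sq_nonneg _) (τ.X.half_pos hi).le)

theorem energyY_term_nonneg {i j : ℕ} (hi : i ≤ τ.X.n) (hj : j ≤ τ.Y.n) (t : ℝ) :
    0 ≤ τ.X.width i * (t ^ 2 / τ.Y.half j) :=
  mul_nonneg (τ.X.width_nonneg hi) (div_nonneg (sq_nonneg _) (τ.Y.half_pos hj).le)

theorem energyY_nonneg : 0 ≤ τ.energyY w :=
  Finset.sum_nonneg fun _ hi => Finset.sum_nonneg fun _ hj =>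
    energyY_term_nonneg (Nat.lt_succ_iff.mp (Finset.mem_range.mp hi))
      (Nat.lt_succ_iff.mp (Finset.mem_range.mp hj)) _

theorem sum_half_width_sq_le (hw : τ.VanishesOnBoundary w) :
    ∑ i ∈ Finset.range (τ.X.n + 1), ∑ j ∈ Finset.range (τ.Y.n + 1),
      τ.X.half i * τ.Y.width j * w i j ^ 2 ≤ τ.energyX w :=
  τ.X.sum_mul_sq_le (fun _ hi => (τ.X.half_pos (Nat.lt_succ_iff.mp (Finset.mem_range.mp hi))).le)
    ((τ.X.sum_half _).trans τ.X.node_last)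
    (fun _ hj => τ.Y.width_nonneg (Nat.lt_succ_iff.mp (Finset.mem_range.mp hj)))
    fun j hj => (hw.1 j (Finset.mem_range.mp hj).le).1

theorem sum_width_width_sq_le (hw : τ.VanishesOnBoundary w) :
    ∑ i ∈ Finset.range (τ.X.n + 1), ∑ j ∈ Finset.range (τ.Y.n + 1),
      τ.X.width i * τ.Y.width j * w i j ^ 2 ≤ τ.energyX w :=
  τ.X.sum_mul_sq_le (fun _ hi => τ.X.width_nonneg (Nat.lt_succ_iff.mp (Finset.mem_range.mp hi)))
    τ.X.sum_width_range
    (fun _ hj => τ.Y.width_nonneg (Nat.lt_succ_iff.mp (Finset.mem_range.mp hj)))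
    fun j hj => (hw.1 j (Finset.mem_range.mp hj).le).1

theorem sum_width_half_sq_le (hw : τ.VanishesOnBoundary w) :
    ∑ i ∈ Finset.range (τ.X.n + 1), ∑ j ∈ Finset.range (τ.Y.n + 1),
      τ.X.width i * τ.Y.half j * w i j ^ 2 ≤ τ.energyY w := by
  have h := τ.Y.sum_mul_sq_le (w := fun j i => w i j)
    (fun _ hj => (τ.Y.half_pos (Nat.lt_succ_iff.mp (Finset.mem_range.mp hj))).le)
    ((τ.Y.sum_half _).trans τ.Y.node_last)
    (fun _ hi => τ.X.width_nonneg (Nat.lt_succ_iff.mp (Finset.mem_range.mp hi)))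
    fun i hi => (hw.2 i (Finset.mem_range.mp hi).le).1
  rw [Finset.sum_comm] at h
  rw [energyY, Finset.sum_comm (s := Finset.range (τ.X.n + 1)) (f := fun i j =>
    τ.X.width i * ((w i (j + 1) - w i j) ^ 2 / τ.Y.half j))]
  simpa only [mul_comm (τ.Y.half _)] using h

theorem sum_fluxX (he : τ.VanishesOnBoundary e) (F : ℕ → ℕ → ℝ) :
    ∑ i ∈ Finset.range τ.X.n, ∑ j ∈ Finset.range τ.Y.n,
        (F (i + 1) (j + 1) - F i (j + 1)) * e (i + 1) (j + 1)
      = -∑ i ∈ Finset.range (τ.X.n + 1), ∑ j ∈ Finset.range (τ.Y.n + 1),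
        F i j * (e (i + 1) j - e i j) := by
  have h (i : ℕ) (hi : i ∈ Finset.range (τ.X.n + 1)) : ∑ j ∈ Finset.range (τ.Y.n + 1),
        F i j * (e (i + 1) j - e i j)
      = ∑ j ∈ Finset.range τ.Y.n, F i (j + 1) * (e (i + 1) (j + 1) - e i (j + 1)) := by
    have := Finset.mem_range.mp hi
    rw [Finset.sum_range_succ', (he.2 i (by omega)).1, (he.2 (i + 1) (by omega)).1]
    simp
  rw [Finset.sum_congr rfl h, Finset.sum_comm, Finset.sum_comm (s := Finset.range (τ.X.n + 1)),
    ← Finset.sum_neg_distrib]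
  refine Finset.sum_congr rfl fun j hj => ?_
  have := Finset.mem_range.mp hj
  exact sum_range_succ_sub_mul (fun i => F i (j + 1)) (fun i => e i (j + 1)) _
    (he.1 _ (by omega)).1 (he.1 _ (by omega)).2

theorem sum_fluxY (he : τ.VanishesOnBoundary e) (G : ℕ → ℕ → ℝ) :
    ∑ i ∈ Finset.range τ.X.n, ∑ j ∈ Finset.range τ.Y.n,
        (G (i + 1) (j + 1) - G (i + 1) j) * e (i + 1) (j + 1)
      = -∑ i ∈ Finset.range (τ.X.n + 1), ∑ j ∈ Finset.range (τ.Y.n + 1),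
        G i j * (e i (j + 1) - e i j) := by
  rw [Finset.sum_range_succ' _ τ.X.n]
  have h0 : ∑ j ∈ Finset.range (τ.Y.n + 1), G 0 j * (e 0 (j + 1) - e 0 j) = 0 :=
    Finset.sum_eq_zero fun j hj => by
      have := Finset.mem_range.mp hj
      rw [(he.1 j (by omega)).1, (he.1 (j + 1) (by omega)).1]
      simp
  rw [h0, add_zero, ← Finset.sum_neg_distrib]
  refine Finset.sum_congr rfl fun i hi => ?_
  have := Finset.mem_range.mp hi
  exact sum_range_succ_sub_mul (fun j => G (i + 1) j) (fun j => e (i + 1) j) _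
    (he.2 _ (by omega)).1 (he.2 _ (by omega)).2

/-- The five-point operator is coercive: tested against `w` it gives the energy. -/
theorem sum_lap_mul (he : τ.VanishesOnBoundary e) :
    ∑ i ∈ Finset.range τ.X.n, ∑ j ∈ Finset.range τ.Y.n,
      τ.lap e (i + 1) (j + 1) * e (i + 1) (j + 1) = τ.energyX e + τ.energyY e := by
  have hX := sum_fluxX he fun i j => -τ.Y.width j * ((e (i + 1) j - e i j) / τ.X.half i)
  have hY := sum_fluxY he fun i j => -τ.X.width i * ((e i (j + 1) - e i j) / τ.Y.half j)
  have eX : τ.energyX e = -∑ i ∈ Finset.range (τ.X.n + 1), ∑ j ∈ Finset.range (τ.Y.n + 1),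
      -τ.Y.width j * ((e (i + 1) j - e i j) / τ.X.half i) * (e (i + 1) j - e i j) := by
    simp only [energyX, ← Finset.sum_neg_distrib]
    exact Finset.sum_congr rfl fun i _ => Finset.sum_congr rfl fun j _ => by ring
  have eY : τ.energyY e = -∑ i ∈ Finset.range (τ.X.n + 1), ∑ j ∈ Finset.range (τ.Y.n + 1),
      -τ.X.width i * ((e i (j + 1) - e i j) / τ.Y.half j) * (e i (j + 1) - e i j) := by
    simp only [energyY, ← Finset.sum_neg_distrib]
    exact Finset.sum_congr rfl fun i _ => Finset.sum_congr rfl fun j _ => by ring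
  rw [eX, eY, ← hX, ← hY]
  simp only [← Finset.sum_add_distrib]
  refine Finset.sum_congr rfl fun i _ => Finset.sum_congr rfl fun j _ => ?_
  simp only [lap, Nat.add_sub_cancel]
  ring

/-! ### Stability -/

/-- Young's inequality for a flux perturbation `F` with `|F| ≤ κ (a + b |z|)`. -/
theorem neg_mul_le_of_abs_le {κ η a b F z t : ℝ} (hκ : 0 ≤ κ) (hη : 0 < η)
    (hF : |F| ≤ κ * (a + b * |z|)) :
    -(F * t) ≤ (1 / 8) * (κ * (t ^ 2 / η)) + 4 * a ^ 2 * (κ * η) + 4 * b ^ 2 * (κ * η * z ^ 2) := by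
  have h1 : -(F * t) ≤ κ * ((a + b * |z|) * |t|) := by
    calc -(F * t) ≤ |F * t| := neg_le_abs _
      _ = |F| * |t| := abs_mul _ _
      _ ≤ κ * (a + b * |z|) * |t| := by gcongr
      _ = _ := by ring
  have hs : t ^ 2 / η = |t| ^ 2 / η := by rw [sq_abs]
  have hz : z ^ 2 = |z| ^ 2 := (sq_abs z).symm
  have h2 : (a + b * |z|) * |t| ≤ (1 / 8) * (t ^ 2 / η) + 4 * a ^ 2 * η + 4 * b ^ 2 * (η * z ^ 2) := by
    rw [hs, hz]
    have hid : (1 / 8) * (|t| ^ 2 / η) + 4 * a ^ 2 * η + 4 * b ^ 2 * (η * |z| ^ 2)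
        - (a + b * |z|) * |t|
        = (|t| - 4 * η * (a + b * |z|)) ^ 2 / (8 * η) + 2 * η * (a - b * |z|) ^ 2 := by
      field_simp
      ring
    have : 0 ≤ (|t| - 4 * η * (a + b * |z|)) ^ 2 / (8 * η) + 2 * η * (a - b * |z|) ^ 2 := by
      positivity
    linarith
  calc _ ≤ _ := h1
    _ ≤ κ * ((1 / 8) * (t ^ 2 / η) + 4 * a ^ 2 * η + 4 * b ^ 2 * (η * z ^ 2)) := by gcongr
    _ = _ := by ring

theorem mul_abs_le_young {κ b d e : ℝ} (hκ : 0 ≤ κ) :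
    κ * (b * |d| * |e|) ≤ 2 * b ^ 2 * (κ * d ^ 2) + (1 / 8) * (κ * e ^ 2) := by
  have : b * |d| * |e| ≤ 2 * (b ^ 2 * d ^ 2) + (1 / 8) * e ^ 2 := by
    rw [← sq_abs d, ← sq_abs e]
    nlinarith [sq_nonneg (4 * (b * |d|) - |e|)]
  calc _ ≤ κ * (2 * (b ^ 2 * d ^ 2) + (1 / 8) * e ^ 2) := by gcongr
    _ = _ := by ring

theorem sum_neg_fluxX_le {a b : ℝ} (he : τ.VanishesOnBoundary e) (hz : τ.VanishesOnBoundary z)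
    (hF : ∀ i ≤ τ.X.n, ∀ j ∈ Finset.Icc 1 τ.Y.n, |F i j| ≤ τ.Y.width j * (a + b * |z i j|)) :
    -∑ i ∈ Finset.range (τ.X.n + 1), ∑ j ∈ Finset.range (τ.Y.n + 1),
        F i j * (e (i + 1) j - e i j)
      ≤ (1 / 8) * τ.energyX e + 4 * a ^ 2 + 4 * b ^ 2 * τ.energyX z := by
  have h1 : ∑ i ∈ Finset.range (τ.X.n + 1), ∑ j ∈ Finset.range (τ.Y.n + 1),
      (4 * a ^ 2) * (τ.Y.width j * τ.X.half i) = 4 * a ^ 2 := by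
    simp only [← Finset.mul_sum, ← Finset.sum_mul]
    rw [τ.X.sum_half, τ.Y.sum_width_range, τ.X.node_last]
    ring
  have h2 := mul_le_mul_of_nonneg_left (sum_half_width_sq_le hz) (by positivity : 0 ≤ 4 * b ^ 2)
  calc _ ≤ ∑ i ∈ Finset.range (τ.X.n + 1), ∑ j ∈ Finset.range (τ.Y.n + 1),
        ((1 / 8) * (τ.Y.width j * ((e (i + 1) j - e i j) ^ 2 / τ.X.half i))
          + (4 * a ^ 2) * (τ.Y.width j * τ.X.half i)
          + (4 * b ^ 2) * (τ.X.half i * τ.Y.width j * z i j ^ 2)) := by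
        simp only [← Finset.sum_neg_distrib]
        refine Finset.sum_le_sum fun i hi => Finset.sum_le_sum fun j hj => ?_
        have hi' := Nat.lt_succ_iff.mp (Finset.mem_range.mp hi)
        have hj' := Nat.lt_succ_iff.mp (Finset.mem_range.mp hj)
        -- The row `j = 0` contributes nothing, whatever the value of `F` there.
        rcases Nat.eq_zero_or_pos j with rfl | hj0
        · rw [(he.2 i (by omega)).1, (he.2 (i + 1) (by omega)).1, τ.Y.width_zero]
          simp
        · rw [mul_comm (τ.X.half i)]
          exact neg_mul_le_of_abs_le (τ.Y.width_nonneg hj') (τ.X.half_pos hi')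
            (hF i hi' j (Finset.mem_Icc.mpr ⟨hj0, hj'⟩))
    _ ≤ _ := by
      simp only [Finset.sum_add_distrib]
      rw [h1]
      simp only [← Finset.mul_sum]
      rw [energyX]
      linarith

theorem sum_neg_fluxY_le {a b : ℝ} (he : τ.VanishesOnBoundary e) (hz : τ.VanishesOnBoundary z)
    (hG : ∀ i ∈ Finset.Icc 1 τ.X.n, ∀ j ≤ τ.Y.n, |G i j| ≤ τ.X.width i * (a + b * |z i j|)) :
    -∑ i ∈ Finset.range (τ.X.n + 1), ∑ j ∈ Finset.range (τ.Y.n + 1),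
        G i j * (e i (j + 1) - e i j)
      ≤ (1 / 8) * τ.energyY e + 4 * a ^ 2 + 4 * b ^ 2 * τ.energyY z := by
  have h1 : ∑ i ∈ Finset.range (τ.X.n + 1), ∑ j ∈ Finset.range (τ.Y.n + 1),
      (4 * a ^ 2) * (τ.X.width i * τ.Y.half j) = 4 * a ^ 2 := by
    simp only [← Finset.mul_sum, ← Finset.sum_mul]
    rw [τ.Y.sum_half, τ.X.sum_width_range, τ.Y.node_last]
    ring
  have h2 := mul_le_mul_of_nonneg_left (sum_width_half_sq_le hz) (by positivity : 0 ≤ 4 * b ^ 2)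
  calc _ ≤ ∑ i ∈ Finset.range (τ.X.n + 1), ∑ j ∈ Finset.range (τ.Y.n + 1),
        ((1 / 8) * (τ.X.width i * ((e i (j + 1) - e i j) ^ 2 / τ.Y.half j))
          + (4 * a ^ 2) * (τ.X.width i * τ.Y.half j)
          + (4 * b ^ 2) * (τ.X.width i * τ.Y.half j * z i j ^ 2)) := by
        simp only [← Finset.sum_neg_distrib]
        refine Finset.sum_le_sum fun i hi => Finset.sum_le_sum fun j hj => ?_
        have hi' := Nat.lt_succ_iff.mp (Finset.mem_range.mp hi)
        have hj' := Nat.lt_succ_iff.mp (Finset.mem_range.mp hj)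
        -- The column `i = 0` contributes nothing, whatever the value of `G` there.
        rcases Nat.eq_zero_or_pos i with rfl | hi0
        · rw [(he.1 j (by omega)).1, (he.1 (j + 1) (by omega)).1, τ.X.width_zero]
          simp
        · exact neg_mul_le_of_abs_le (τ.X.width_nonneg hi') (τ.Y.half_pos hj')
            (hG i (Finset.mem_Icc.mpr ⟨hi0, hi'⟩) j hj')
    _ ≤ _ := by
      simp only [Finset.sum_add_distrib]
      rw [h1]
      rw [energyY]
      simp only [← Finset.mul_sum] at h2 ⊢
      linarith

theorem plus_mul_dY_sq_le {i j : ℕ} (hi : i ≤ τ.X.n) (hj : j ≤ τ.Y.n) :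
    τ.X.width i * τ.Y.plus j * τ.dY z i j ^ 2
      ≤ τ.X.width i * ((z i (j + 1) - z i j) ^ 2 / τ.Y.half j) := by
  have hp := τ.Y.half_pos hj
  have hle : τ.Y.plus j ≤ τ.Y.half j := by
    rw [τ.Y.half_eq]; linarith [τ.Y.minus_succ_nonneg hj]
  have hw := τ.X.width_nonneg hi
  calc _ ≤ τ.X.width i * τ.Y.half j * τ.dY z i j ^ 2 := by gcongr
    _ = _ := by rw [dY]; field_simp

theorem minus_mul_dY_sq_le {i j : ℕ} (hi : i ≤ τ.X.n) (hj : j ≤ τ.Y.n) :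
    τ.X.width i * τ.Y.minus (j + 1) * τ.dY z i j ^ 2
      ≤ τ.X.width i * ((z i (j + 1) - z i j) ^ 2 / τ.Y.half j) := by
  have hp := τ.Y.half_pos hj
  have hle : τ.Y.minus (j + 1) ≤ τ.Y.half j := by
    rw [τ.Y.half_eq]; linarith [τ.Y.plus_nonneg hj]
  have hw := τ.X.width_nonneg hi
  calc _ ≤ τ.X.width i * τ.Y.half j * τ.dY z i j ^ 2 := by gcongr
    _ = _ := by rw [dY]; field_simp

theorem plus_mul_dX_sq_le {i j : ℕ} (hi : i ≤ τ.X.n) (hj : j ≤ τ.Y.n) :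
    τ.Y.width j * τ.X.plus i * τ.dX z i j ^ 2
      ≤ τ.Y.width j * ((z (i + 1) j - z i j) ^ 2 / τ.X.half i) := by
  have hp := τ.X.half_pos hi
  have hle : τ.X.plus i ≤ τ.X.half i := by
    rw [τ.X.half_eq]; linarith [τ.X.minus_succ_nonneg hi]
  have hw := τ.Y.width_nonneg hj
  calc _ ≤ τ.Y.width j * τ.X.half i * τ.dX z i j ^ 2 := by gcongr
    _ = _ := by rw [dX]; field_simp

theorem minus_mul_dX_sq_le {i j : ℕ} (hi : i ≤ τ.X.n) (hj : j ≤ τ.Y.n) :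
    τ.Y.width j * τ.X.minus (i + 1) * τ.dX z i j ^ 2
      ≤ τ.Y.width j * ((z (i + 1) j - z i j) ^ 2 / τ.X.half i) := by
  have hp := τ.X.half_pos hi
  have hle : τ.X.minus (i + 1) ≤ τ.X.half i := by
    rw [τ.X.half_eq]; linarith [τ.X.plus_nonneg hi]
  have hw := τ.Y.width_nonneg hj
  calc _ ≤ τ.Y.width j * τ.X.half i * τ.dX z i j ^ 2 := by gcongr
    _ = _ := by rw [dX]; field_simp

/-- The size of a source term that is not in divergence form: a part of order `a`, and the four
divided differences of `z` weighted by `b` and the distances of the node to the faces. -/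
noncomputable def sourceBound (τ : Mesh) (a b : ℝ) (z : ℕ → ℕ → ℝ) (i j : ℕ) : ℝ :=
  τ.X.width i * τ.Y.width j * a
    + (τ.X.width i * τ.Y.plus j * (b * |τ.dY z i j|)
      + τ.X.width i * τ.Y.minus j * (b * |τ.dY z i (j - 1)|))
    + (τ.Y.width j * τ.X.plus i * (b * |τ.dX z i j|)
      + τ.Y.width j * τ.X.minus i * (b * |τ.dX z (i - 1) j|))

/-- Young's inequality for the source term. The distance `plus j` or `minus j` of the node to a face
is at most the distance `half` between the neighbouring nodes, which turns the squared divided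
differences into terms of the energy of `z`. -/
theorem source_mul_le {a b : ℝ} {i j : ℕ} (hi : i < τ.X.n) (hj : j < τ.Y.n)
    (hD : |D (i + 1) (j + 1)| ≤ τ.sourceBound a b z (i + 1) (j + 1)) :
    D (i + 1) (j + 1) * e (i + 1) (j + 1)
      ≤ 2 * a ^ 2 * (τ.X.width (i + 1) * τ.Y.width (j + 1))
        + 2 * b ^ 2 * (τ.X.width (i + 1) *
          ((z (i + 1) (j + 2) - z (i + 1) (j + 1)) ^ 2 / τ.Y.half (j + 1)))
        + 2 * b ^ 2 * (τ.X.width (i + 1) * ((z (i + 1) (j + 1) - z (i + 1) j) ^ 2 / τ.Y.half j))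
        + 2 * b ^ 2 * (τ.Y.width (j + 1) *
          ((z (i + 2) (j + 1) - z (i + 1) (j + 1)) ^ 2 / τ.X.half (i + 1)))
        + 2 * b ^ 2 * (τ.Y.width (j + 1) * ((z (i + 1) (j + 1) - z i (j + 1)) ^ 2 / τ.X.half i))
        + 3 / 8 * (τ.X.width (i + 1) * τ.Y.width (j + 1) * e (i + 1) (j + 1) ^ 2) := by
  have hx := τ.X.width_nonneg (i := i + 1) (by omega)
  have hy := τ.Y.width_nonneg (i := j + 1) (by omega)
  have hxp := τ.X.plus_nonneg (i := i + 1) (by omega)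
  have hxm := τ.X.minus_succ_nonneg (i := i) (by omega)
  have hyp := τ.Y.plus_nonneg (i := j + 1) (by omega)
  have hym := τ.Y.minus_succ_nonneg (i := j) (by omega)
  have hxs := τ.X.minus_add_plus (i := i + 1) (by omega) (by omega)
  have hys := τ.Y.minus_add_plus (i := j + 1) (by omega) (by omega)
  set E := e (i + 1) (j + 1) with hE
  have h0 : D (i + 1) (j + 1) * E ≤ τ.sourceBound a b z (i + 1) (j + 1) * |E| := by
    calc _ ≤ |D (i + 1) (j + 1)| * |E| := (le_abs_self _).trans (abs_mul _ _).le
      _ ≤ _ := by gcongr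
  have hb : 0 ≤ 2 * b ^ 2 := by positivity
  have y0 := mul_abs_le_young (b := a) (d := 1) (e := E) (mul_nonneg hx hy)
  have y1 := mul_abs_le_young (b := b) (d := τ.dY z (i + 1) (j + 1)) (e := E) (mul_nonneg hx hyp)
  have y2 := mul_abs_le_young (b := b) (d := τ.dY z (i + 1) j) (e := E) (mul_nonneg hx hym)
  have y3 := mul_abs_le_young (b := b) (d := τ.dX z (i + 1) (j + 1)) (e := E) (mul_nonneg hy hxp)
  have y4 := mul_abs_le_young (b := b) (d := τ.dX z i (j + 1)) (e := E) (mul_nonneg hy hxm)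
  have q1 := mul_le_mul_of_nonneg_left
    (plus_mul_dY_sq_le (τ := τ) (z := z) (i := i + 1) (j := j + 1) (by omega) (by omega)) hb
  have q2 := mul_le_mul_of_nonneg_left
    (minus_mul_dY_sq_le (τ := τ) (z := z) (i := i + 1) (j := j) (by omega) (by omega)) hb
  have q3 := mul_le_mul_of_nonneg_left
    (plus_mul_dX_sq_le (τ := τ) (z := z) (i := i + 1) (j := j + 1) (by omega) (by omega)) hb
  have q4 := mul_le_mul_of_nonneg_left
    (minus_mul_dX_sq_le (τ := τ) (z := z) (i := i) (j := j + 1) (by omega) (by omega)) hb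
  have r1 : τ.X.width (i + 1) * τ.Y.plus (j + 1) * E ^ 2
      + τ.X.width (i + 1) * τ.Y.minus (j + 1) * E ^ 2
      = τ.X.width (i + 1) * τ.Y.width (j + 1) * E ^ 2 := by rw [← hys]; ring
  have r2 : τ.Y.width (j + 1) * τ.X.plus (i + 1) * E ^ 2
      + τ.Y.width (j + 1) * τ.X.minus (i + 1) * E ^ 2
      = τ.X.width (i + 1) * τ.Y.width (j + 1) * E ^ 2 := by rw [← hxs]; ring
  simp only [abs_one, mul_one, one_pow] at y0
  simp only [sourceBound, Nat.add_sub_cancel] at h0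
  linarith

theorem sum_source_le {a b : ℝ} (he : τ.VanishesOnBoundary e)
    (hD : ∀ i ∈ Finset.Icc 1 τ.X.n, ∀ j ∈ Finset.Icc 1 τ.Y.n, |D i j| ≤ τ.sourceBound a b z i j) :
    ∑ i ∈ Finset.range τ.X.n, ∑ j ∈ Finset.range τ.Y.n, D (i + 1) (j + 1) * e (i + 1) (j + 1)
      ≤ 2 * a ^ 2 + 4 * b ^ 2 * (τ.energyX z + τ.energyY z) + 3 / 8 * τ.energyX e := by
  have hb : 0 ≤ 2 * b ^ 2 := by positivity
  have s0 : ∑ i ∈ Finset.range τ.X.n, ∑ j ∈ Finset.range τ.Y.n,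
      τ.X.width (i + 1) * τ.Y.width (j + 1) ≤ 1 := by
    refine (sum_shift_shift_le (q := fun i j => τ.X.width i * τ.Y.width j) fun i hi j hj =>
      mul_nonneg (τ.X.width_nonneg hi) (τ.Y.width_nonneg hj)).trans ?_
    rw [← Finset.sum_mul_sum, τ.X.sum_width_range, τ.Y.sum_width_range, one_mul]
  have s1 := sum_shift_shift_le (m := τ.X.n) (n := τ.Y.n)
    (q := fun i j => τ.X.width i * ((z i (j + 1) - z i j) ^ 2 / τ.Y.half j))
    fun i hi j hj => energyY_term_nonneg hi hj _
  have s2 := sum_shift_init_le (m := τ.X.n) (n := τ.Y.n)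
    (q := fun i j => τ.X.width i * ((z i (j + 1) - z i j) ^ 2 / τ.Y.half j))
    fun i hi j hj => energyY_term_nonneg hi hj _
  have s3 := sum_shift_shift_le (m := τ.X.n) (n := τ.Y.n)
    (q := fun i j => τ.Y.width j * ((z (i + 1) j - z i j) ^ 2 / τ.X.half i))
    fun i hi j hj => energyX_term_nonneg hi hj _
  have s4 := sum_init_shift_le (m := τ.X.n) (n := τ.Y.n)
    (q := fun i j => τ.Y.width j * ((z (i + 1) j - z i j) ^ 2 / τ.X.half i))
    fun i hi j hj => energyX_term_nonneg hi hj _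
  have s5 := (sum_shift_shift_le (m := τ.X.n) (n := τ.Y.n)
    (q := fun i j => τ.X.width i * τ.Y.width j * e i j ^ 2) fun i hi j hj =>
      mul_nonneg (mul_nonneg (τ.X.width_nonneg hi) (τ.Y.width_nonneg hj)) (sq_nonneg _)).trans
    (sum_width_width_sq_le he)
  refine (Finset.sum_le_sum fun i hi => Finset.sum_le_sum fun j hj => source_mul_le
    (Finset.mem_range.mp hi) (Finset.mem_range.mp hj)
    (hD _ (Finset.mem_Icc.mpr ⟨by omega, Finset.mem_range.mp hi⟩) _
      (Finset.mem_Icc.mpr ⟨by omega, Finset.mem_range.mp hj⟩))).trans ?_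
  simp only [Finset.sum_add_distrib, ← Finset.mul_sum]
  rw [← energyY] at s1 s2
  rw [← energyX] at s3 s4
  simp only [Nat.add_assoc, Nat.reduceAdd] at s1 s3
  have t0 := mul_le_mul_of_nonneg_left s0 (by positivity : 0 ≤ 2 * a ^ 2)
  simp only [← Finset.mul_sum] at t0
  have t1 := mul_le_mul_of_nonneg_left s1 hb
  have t2 := mul_le_mul_of_nonneg_left s2 hb
  have t3 := mul_le_mul_of_nonneg_left s3 hb
  have t4 := mul_le_mul_of_nonneg_left s4 hb
  simp only [← Finset.mul_sum] at t1 t2 t3 t4 s5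
  linarith

/-- Stability of the five-point scheme. The perturbation consists of flux differences, with fluxes
of order `a + b |z|`, and of a source term bounded by `sourceBound`. -/
theorem energy_le {a b : ℝ} (he : τ.VanishesOnBoundary e) (hz : τ.VanishesOnBoundary z)
    (hlap : ∀ i ∈ Finset.Icc 1 τ.X.n, ∀ j ∈ Finset.Icc 1 τ.Y.n,
      τ.lap e i j = (F i j - F (i - 1) j) + (G i j - G i (j - 1)) + D i j)
    (hF : ∀ i ≤ τ.X.n, ∀ j ∈ Finset.Icc 1 τ.Y.n, |F i j| ≤ τ.Y.width j * (a + b * |z i j|))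
    (hG : ∀ i ∈ Finset.Icc 1 τ.X.n, ∀ j ≤ τ.Y.n, |G i j| ≤ τ.X.width i * (a + b * |z i j|))
    (hD : ∀ i ∈ Finset.Icc 1 τ.X.n, ∀ j ∈ Finset.Icc 1 τ.Y.n, |D i j| ≤ τ.sourceBound a b z i j) :
    τ.energyX e + τ.energyY e ≤ 20 * a ^ 2 + 16 * b ^ 2 * (τ.energyX z + τ.energyY z) := by
  have h1 : τ.energyX e + τ.energyY e
      = (-∑ i ∈ Finset.range (τ.X.n + 1), ∑ j ∈ Finset.range (τ.Y.n + 1),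
          F i j * (e (i + 1) j - e i j))
        + (-∑ i ∈ Finset.range (τ.X.n + 1), ∑ j ∈ Finset.range (τ.Y.n + 1),
          G i j * (e i (j + 1) - e i j))
        + ∑ i ∈ Finset.range τ.X.n, ∑ j ∈ Finset.range τ.Y.n,
          D (i + 1) (j + 1) * e (i + 1) (j + 1) := by
    rw [← sum_lap_mul he, ← sum_fluxX he, ← sum_fluxY he]
    simp only [← Finset.sum_add_distrib]
    refine Finset.sum_congr rfl fun i hi => Finset.sum_congr rfl fun j hj => ?_
    rw [hlap (i + 1) (Finset.mem_Icc.mpr ⟨by omega, Finset.mem_range.mp hi⟩) (j + 1)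
      (Finset.mem_Icc.mpr ⟨by omega, Finset.mem_range.mp hj⟩), Nat.add_sub_cancel,
      Nat.add_sub_cancel]
    ring
  have hX := sum_neg_fluxX_le he hz hF
  have hY := sum_neg_fluxY_le he hz hG
  have hS := sum_source_le he hD
  have := energyY_nonneg (τ := τ) (w := e)
  linarith

/-! ### Existence and uniqueness of discrete solutions -/

theorem lap_add (w w' : ℕ → ℕ → ℝ) (i j : ℕ) :
    τ.lap (fun i j => w i j + w' i j) i j = τ.lap w i j + τ.lap w' i j := by
  simp only [lap]; ring

theorem lap_sub (w w' : ℕ → ℕ → ℝ) (i j : ℕ) :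
    τ.lap (fun i j => w i j - w' i j) i j = τ.lap w i j - τ.lap w' i j := by
  simp only [lap]; ring

theorem lap_smul (r : ℝ) (w : ℕ → ℕ → ℝ) (i j : ℕ) :
    τ.lap (fun i j => r * w i j) i j = r * τ.lap w i j := by
  simp only [lap]; ring

theorem eq_zero_of_lap_eq_zero (hw : τ.VanishesOnBoundary w)
    (hlap : ∀ i ∈ Finset.Icc 1 τ.X.n, ∀ j ∈ Finset.Icc 1 τ.Y.n, τ.lap w i j = 0) {i j : ℕ}
    (hi : i ∈ Finset.Icc 1 τ.X.n) (hj : j ∈ Finset.Icc 1 τ.Y.n) : w i j = 0 := by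
  have h0 : τ.energyX w + τ.energyY w = 0 := by
    rw [← sum_lap_mul hw]
    refine Finset.sum_eq_zero fun i hi => Finset.sum_eq_zero fun j hj => ?_
    rw [hlap _ (Finset.mem_Icc.mpr ⟨by omega, Finset.mem_range.mp hi⟩) _
      (Finset.mem_Icc.mpr ⟨by omega, Finset.mem_range.mp hj⟩), zero_mul]
  have h1 := sum_width_width_sq_le hw
  have h2 := energyY_nonneg (τ := τ) (w := w)
  have hi' := Finset.mem_Icc.mp hi
  have hj' := Finset.mem_Icc.mp hj
  have hnn : ∀ i ∈ Finset.range (τ.X.n + 1), ∀ j ∈ Finset.range (τ.Y.n + 1),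
      0 ≤ τ.X.width i * τ.Y.width j * w i j ^ 2 := fun i hi j hj =>
    mul_nonneg (mul_nonneg (τ.X.width_nonneg (Nat.lt_succ_iff.mp (Finset.mem_range.mp hi)))
      (τ.Y.width_nonneg (Nat.lt_succ_iff.mp (Finset.mem_range.mp hj)))) (sq_nonneg _)
  have hir : i ∈ Finset.range (τ.X.n + 1) := Finset.mem_range.mpr (by omega)
  have hjr : j ∈ Finset.range (τ.Y.n + 1) := Finset.mem_range.mpr (by omega)
  have h3 : τ.X.width i * τ.Y.width j * w i j ^ 2 ≤ 0 :=
    (Finset.single_le_sum (f := fun j => τ.X.width i * τ.Y.width j * w i j ^ 2)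
      (fun j hj => hnn i hir j hj) hjr).trans
      ((Finset.single_le_sum (f := fun i => ∑ j ∈ Finset.range (τ.Y.n + 1),
        τ.X.width i * τ.Y.width j * w i j ^ 2)
        (fun i hi => Finset.sum_nonneg (hnn i hi)) hir).trans (by linarith))
  have hpos := mul_pos (τ.X.width_pos i hi) (τ.Y.width_pos j hj)
  exact (pow_eq_zero_iff two_ne_zero).mp (le_antisymm (nonpos_of_mul_nonpos_right h3 hpos)
    (sq_nonneg (w i j)))

/-- Extension by zero of a family of values at the interior indices. -/
def extend (τ : Mesh) (x : Fin τ.X.n → Fin τ.Y.n → ℝ) (i j : ℕ) : ℝ :=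
  if h : (1 ≤ i ∧ i ≤ τ.X.n) ∧ (1 ≤ j ∧ j ≤ τ.Y.n) then
    x ⟨i - 1, by omega⟩ ⟨j - 1, by omega⟩ else 0

theorem extend_eq_zero (x : Fin τ.X.n → Fin τ.Y.n → ℝ) {i j : ℕ}
    (h : ¬((1 ≤ i ∧ i ≤ τ.X.n) ∧ (1 ≤ j ∧ j ≤ τ.Y.n))) : τ.extend x i j = 0 := dif_neg h

theorem vanishesOnBoundary_extend (x : Fin τ.X.n → Fin τ.Y.n → ℝ) :
    τ.VanishesOnBoundary (τ.extend x) :=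
  ⟨fun _ _ => ⟨extend_eq_zero x (by omega), extend_eq_zero x (by omega)⟩,
    fun _ _ => ⟨extend_eq_zero x (by omega), extend_eq_zero x (by omega)⟩⟩

/-- The five-point operator with homogeneous boundary values, on the interior indices. -/
noncomputable def lapLinear (τ : Mesh) :
    (Fin τ.X.n → Fin τ.Y.n → ℝ) →ₗ[ℝ] (Fin τ.X.n → Fin τ.Y.n → ℝ) where
  toFun x i j := τ.lap (τ.extend x) (i + 1) (j + 1)
  map_add' x y := by
    funext i j
    have : τ.extend (x + y) = fun i j => τ.extend x i j + τ.extend y i j := by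
      funext i j; simp only [extend]; split_ifs <;> simp
    rw [this]
    exact lap_add _ _ _ _
  map_smul' r x := by
    funext i j
    have : τ.extend (r • x) = fun i j => r * τ.extend x i j := by
      funext i j; simp only [extend]; split_ifs <;> simp
    rw [this]
    exact lap_smul _ _ _ _

theorem lapLinear_injective : Function.Injective τ.lapLinear := by
  rw [← LinearMap.ker_eq_bot, LinearMap.ker_eq_bot']
  intro x hx
  funext i j
  have h := eq_zero_of_lap_eq_zero (vanishesOnBoundary_extend x) (i := i + 1) (j := j + 1)
    (fun k hk l hl => by
      obtain ⟨hk1, hk2⟩ := Finset.mem_Icc.mp hk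
      obtain ⟨hl1, hl2⟩ := Finset.mem_Icc.mp hl
      have := congrFun (congrFun hx ⟨k - 1, by omega⟩) ⟨l - 1, by omega⟩
      simpa [lapLinear, Nat.sub_add_cancel hk1, Nat.sub_add_cancel hl1] using this)
    (Finset.mem_Icc.mpr ⟨by omega, i.2⟩) (Finset.mem_Icc.mpr ⟨by omega, j.2⟩)
  rw [extend, dif_pos ⟨⟨by omega, i.2⟩, ⟨by omega, j.2⟩⟩] at h
  simpa using h

/-- The five-point scheme is uniquely solvable: injectivity follows from coercivity, and an
injective endomorphism of a finite-dimensional space is surjective. -/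
theorem existsUnique_isSolution (bdry rhs : ℕ → ℕ → ℝ) : ∃! w, τ.IsSolution bdry rhs w := by
  let B : ℕ → ℕ → ℝ := fun i j =>
    if (1 ≤ i ∧ i ≤ τ.X.n) ∧ (1 ≤ j ∧ j ≤ τ.Y.n) then 0
    else if i ≤ τ.X.n + 1 ∧ j ≤ τ.Y.n + 1 then bdry i j else 0
  have hB {i j : ℕ} (h : ¬((1 ≤ i ∧ i ≤ τ.X.n) ∧ (1 ≤ j ∧ j ≤ τ.Y.n)))
      (h' : i ≤ τ.X.n + 1 ∧ j ≤ τ.Y.n + 1) : B i j = bdry i j := by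
    simp only [B]; rw [if_neg h, if_pos h']
  obtain ⟨x, hx⟩ := (LinearMap.injective_iff_surjective.mp (lapLinear_injective (τ := τ)))
    fun i j => rhs (i + 1) (j + 1) - τ.lap B (i + 1) (j + 1)
  refine ⟨fun i j => B i j + τ.extend x i j, ⟨?_, ?_, ?_, ?_, ?_, ?_⟩, ?_⟩
  · intro j hj
    rw [hB (by omega) (by omega), extend_eq_zero x (by omega), add_zero]
  · intro j hj
    rw [hB (by omega) (by omega), extend_eq_zero x (by omega), add_zero]
  · intro i hi
    rw [hB (by omega) (by omega), extend_eq_zero x (by omega), add_zero]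
  · intro i hi
    rw [hB (by omega) (by omega), extend_eq_zero x (by omega), add_zero]
  · intro i hi j hj
    obtain ⟨hi1, hi2⟩ := Finset.mem_Icc.mp hi
    obtain ⟨hj1, hj2⟩ := Finset.mem_Icc.mp hj
    have h := congrFun (congrFun hx ⟨i - 1, by omega⟩) ⟨j - 1, by omega⟩
    simp only [lapLinear, LinearMap.coe_mk, AddHom.coe_mk, Nat.sub_add_cancel hi1,
      Nat.sub_add_cancel hj1] at h
    rw [lap_add, h]
    ring
  · intro i j h
    simp only [B]
    rw [if_neg (by omega), if_neg (by omega), extend_eq_zero x (by omega), add_zero]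
  · intro w' hw'
    set w : ℕ → ℕ → ℝ := fun i j => B i j + τ.extend x i j with hw
    have hvan : τ.VanishesOnBoundary fun i j => w' i j - w i j := by
      refine ⟨fun j hj => ⟨?_, ?_⟩, fun i hi => ⟨?_, ?_⟩⟩
      · simp only [hw]
        rw [hw'.left j hj, hB (by omega) (by omega), extend_eq_zero x (by omega)]; ring
      · simp only [hw]
        rw [hw'.right j hj, hB (by omega) (by omega), extend_eq_zero x (by omega)]; ring
      · simp only [hw]
        rw [hw'.bottom i hi, hB (by omega) (by omega), extend_eq_zero x (by omega)]; ring
      · simp only [hw]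
        rw [hw'.top i hi, hB (by omega) (by omega), extend_eq_zero x (by omega)]; ring
    have hlap : ∀ i ∈ Finset.Icc 1 τ.X.n, ∀ j ∈ Finset.Icc 1 τ.Y.n,
        τ.lap (fun i j => w' i j - w i j) i j = 0 := by
      intro i hi j hj
      rw [lap_sub, hw'.scheme i hi j hj, hw, lap_add]
      obtain ⟨hi1, hi2⟩ := Finset.mem_Icc.mp hi
      obtain ⟨hj1, hj2⟩ := Finset.mem_Icc.mp hj
      have h := congrFun (congrFun hx ⟨i - 1, by omega⟩) ⟨j - 1, by omega⟩
      simp only [lapLinear, LinearMap.coe_mk, AddHom.coe_mk, Nat.sub_add_cancel hi1,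
        Nat.sub_add_cancel hj1] at h
      rw [h]
      ring
    funext i j
    by_cases hout : τ.X.n + 1 < i ∨ τ.Y.n + 1 < j
    · rw [hw'.outside i j hout]
      simp only [hw, B]
      rw [if_neg (by omega), if_neg (by omega), extend_eq_zero x (by omega), add_zero]
    by_cases hin : (1 ≤ i ∧ i ≤ τ.X.n) ∧ (1 ≤ j ∧ j ≤ τ.Y.n)
    · exact sub_eq_zero.mp (eq_zero_of_lap_eq_zero hvan hlap (Finset.mem_Icc.mpr hin.1)
        (Finset.mem_Icc.mpr hin.2))
    rcases (by omega : i = 0 ∨ i = τ.X.n + 1 ∨ j = 0 ∨ j = τ.Y.n + 1) with rfl | rfl | rfl | rfl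
    · exact sub_eq_zero.mp (hvan.1 j (by omega)).1
    · exact sub_eq_zero.mp (hvan.1 j (by omega)).2
    · exact sub_eq_zero.mp (hvan.2 i (by omega)).1
    · exact sub_eq_zero.mp (hvan.2 i (by omega)).2

end Mesh

/-! ### Mixed partial derivatives -/

/-- The coordinate directions. -/
inductive Dir
  | x
  | y

/-- The iterated partial derivative of `u` along a word in the coordinate directions, the last
letter acting first. -/
noncomputable def mixed : List Dir → (ℝ × ℝ → ℝ) → ℝ × ℝ → ℝ
  | [], u => u
  | Dir.x :: l, u => partialX (mixed l u)
  | Dir.y :: l, u => partialY (mixed l u)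

/-- The number of derivatives in `x`. -/
def numX : List Dir → ℕ
  | [] => 0
  | Dir.x :: l => numX l + 1
  | Dir.y :: l => numX l

/-- The number of derivatives in `y`. -/
def numY : List Dir → ℕ
  | [] => 0
  | Dir.x :: l => numY l
  | Dir.y :: l => numY l + 1

theorem numX_add_numY (l : List Dir) : numX l + numY l = l.length := by
  induction l with
  | nil => rfl
  | cons d l ih => cases d <;> simp only [numX, numY, List.length_cons] <;> omega

section Mixed

variable {u : ℝ × ℝ → ℝ} {m : ℕ}

theorem partialY_iterate_partialX {g : ℝ × ℝ → ℝ} (a : ℕ)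
    (hg : ContDiffOn ℝ (a + 1 : ℕ) g closedSquare) :
    EqOn (partialY (partialX^[a] g)) (partialX^[a] (partialY g)) closedSquare := by
  induction a with
  | zero => exact fun _ _ => rfl
  | succ a ih =>
    intro p hp
    rw [Function.iterate_succ_apply', Function.iterate_succ_apply']
    have h2 : ContDiffOn ℝ (2 : ℕ) (partialX^[a] g) closedSquare :=
      contDiffOn_iterate_partialX a (hg.of_le (by norm_cast; omega))
    rw [← partialX_partialY_comm h2 hp]
    exact partialX_congr (ih (hg.of_le (by norm_cast; omega))) hp

theorem contDiffOn_mixed (l : List Dir) {k : ℕ} (hu : ContDiffOn ℝ m u closedSquare)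
    (h : k + l.length ≤ m) : ContDiffOn ℝ k (mixed l u) closedSquare := by
  induction l generalizing k with
  | nil => exact hu.of_le (by norm_cast)
  | cons d l ih =>
    have := ih (k := k + 1) (by simp only [List.length_cons] at h; omega)
    cases d
    · exact contDiffOn_partialX this (by norm_cast)
    · exact contDiffOn_partialY this (by norm_cast)

/-- The order of differentiation does not matter. -/
theorem mixed_eq_partialD (l : List Dir) (hu : ContDiffOn ℝ m u closedSquare)
    (h : l.length ≤ m) : EqOn (mixed l u) (partialD (numX l) (numY l) u) closedSquare := by
  induction l with
  | nil => exact fun _ _ => rfl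
  | cons d l ih =>
    simp only [List.length_cons] at h
    have ih' := ih (by omega)
    have hl := numX_add_numY l
    cases d
    · intro p hp
      simp only [mixed, numX, numY, partialD]
      rw [Function.iterate_succ_apply']
      exact partialX_congr ih' hp
    · intro p hp
      simp only [mixed, numX, numY, partialD]
      rw [partialY_congr ih' hp, Function.iterate_succ_apply']
      exact partialY_iterate_partialX _ (contDiffOn_iterate_partialY _
        (hu.of_le (by norm_cast; omega))) hp

theorem mixed_eq_mixed {l l' : List Dir} (hu : ContDiffOn ℝ m u closedSquare)
    (h : l.length ≤ m) (hx : numX l = numX l') (hy : numY l = numY l') :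
    EqOn (mixed l u) (mixed l' u) closedSquare := by
  intro p hp
  have hl := numX_add_numY l
  have hl' := numX_add_numY l'
  rw [mixed_eq_partialD l hu h hp, mixed_eq_partialD l' hu (by omega) hp, hx, hy]

theorem abs_mixed_le (l : List Dir) (hu : ContDiffOn ℝ m u closedSquare) (h : l.length ≤ m)
    {p : ℝ × ℝ} (hp : p ∈ closedSquare) : |mixed l u p| ≤ cNorm m u := by
  rw [mixed_eq_partialD l hu h hp]
  exact abs_partialD_le_cNorm hu (by rw [numX_add_numY]; exact h) hp

theorem cNorm_nonneg (m : ℕ) (u : ℝ × ℝ → ℝ) : 0 ≤ cNorm m u :=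
  Real.sSup_nonneg fun _ ⟨_, _, _, _, _, hr⟩ => hr ▸ abs_nonneg _

theorem hasDerivWithinAt_mixedX (l : List Dir) (hu : ContDiffOn ℝ m u closedSquare)
    (h : l.length + 1 ≤ m) {y : ℝ} (hy : y ∈ Icc (0 : ℝ) 1) :
    ∀ s ∈ Icc (0 : ℝ) 1, HasDerivWithinAt (fun s => mixed l u (s, y)) (mixed (Dir.x :: l) u (s, y))
      (Icc 0 1) s := fun _ hs =>
  hasDerivWithinAt_partialX (by exact_mod_cast contDiffOn_mixed (k := 1) l hu (by omega)) hs hy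

theorem hasDerivWithinAt_mixedY (l : List Dir) (hu : ContDiffOn ℝ m u closedSquare)
    (h : l.length + 1 ≤ m) {x : ℝ} (hx : x ∈ Icc (0 : ℝ) 1) :
    ∀ t ∈ Icc (0 : ℝ) 1, HasDerivWithinAt (fun t => mixed l u (x, t)) (mixed (Dir.y :: l) u (x, t))
      (Icc 0 1) t := fun _ ht =>
  hasDerivWithinAt_partialY (by exact_mod_cast contDiffOn_mixed (k := 1) l hu (by omega)) hx ht

end Mixed

/-! ### Boundary values -/

theorem partialX_partialX_eq_zero {u : ℝ × ℝ → ℝ} {x y : ℝ} (hx : x ∈ Icc (0 : ℝ) 1)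
    (h : ∀ s ∈ Icc (0 : ℝ) 1, u (s, y) = 0) : partialX (partialX u) (x, y) = 0 := by
  have h1 : ∀ s ∈ Icc (0 : ℝ) 1, partialX u (s, y) = 0 := fun s hs => by
    rw [partialX, derivWithin_congr (f := fun _ => (0 : ℝ)) h (h s hs)]
    simp
  rw [partialX, derivWithin_congr (f := fun _ => (0 : ℝ)) h1 (h1 x hx)]
  simp

theorem partialY_partialY_eq_zero {u : ℝ × ℝ → ℝ} {x y : ℝ} (hy : y ∈ Icc (0 : ℝ) 1)
    (h : ∀ t ∈ Icc (0 : ℝ) 1, u (x, t) = 0) : partialY (partialY u) (x, y) = 0 := by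
  have h1 : ∀ t ∈ Icc (0 : ℝ) 1, partialY u (x, t) = 0 := fun t ht => by
    rw [partialY, derivWithin_congr (f := fun _ => (0 : ℝ)) h (h t ht)]
    simp
  rw [partialY, derivWithin_congr (f := fun _ => (0 : ℝ)) h1 (h1 y hy)]
  simp

theorem mem_frontier_of_left_or_right {x y : ℝ} (hx : x = 0 ∨ x = 1) (hy : y ∈ Icc (0 : ℝ) 1) :
    (x, y) ∈ frontier openSquare := by
  rw [frontier_openSquare]
  rcases hx with rfl | rfl
  · exact ⟨⟨by simp, hy⟩, fun h => absurd h.1.1 (lt_irrefl _)⟩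
  · exact ⟨⟨by simp, hy⟩, fun h => absurd h.1.2 (lt_irrefl _)⟩

theorem mem_frontier_of_bottom_or_top {x y : ℝ} (hx : x ∈ Icc (0 : ℝ) 1) (hy : y = 0 ∨ y = 1) :
    (x, y) ∈ frontier openSquare := by
  rw [frontier_openSquare]
  rcases hy with rfl | rfl
  · exact ⟨⟨hx, by simp⟩, fun h => absurd h.2.1 (lt_irrefl _)⟩
  · exact ⟨⟨hx, by simp⟩, fun h => absurd h.2.2 (lt_irrefl _)⟩

/-! ### Consistency of the fluxes -/

section Flux

variable {P Q : Partition} {φ φ₁ φ₂ φ₃ ψ ψ₁ ψ₂ : ℝ → ℝ} {h U : ℝ} {i j : ℕ}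

/-- A difference quotient approximates the derivative at any point in between. -/
theorem abs_div_sub_deriv_le
    (hφ : ∀ s ∈ Icc (0 : ℝ) 1, HasDerivWithinAt φ (φ₁ s) (Icc 0 1) s)
    (hφ₁ : ∀ s ∈ Icc (0 : ℝ) 1, HasDerivWithinAt φ₁ (φ₂ s) (Icc 0 1) s)
    (hU : ∀ s ∈ Icc (0 : ℝ) 1, |φ₂ s| ≤ U) {a b c L : ℝ}
    (ha : a ∈ Icc (0 : ℝ) 1) (hb : b ∈ Icc (0 : ℝ) 1) (hab : a < b) (hac : a ≤ c) (hcb : c ≤ b)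
    (h1 : c - a ≤ L) (h2 : b - c ≤ L) :
    |(φ b - φ a) / (b - a) - φ₁ c| ≤ L * U := by
  have hU0 : 0 ≤ U := (abs_nonneg _).trans (hU a ha)
  have hc : c ∈ Icc (0 : ℝ) 1 := ⟨ha.1.trans hac, hcb.trans hb.2⟩
  refine abs_div_sub_le hφ ha hb hab fun s hs => ?_
  have hs' : s ∈ Icc (0 : ℝ) 1 := ⟨ha.1.trans hs.1, hs.2.trans hb.2⟩
  calc _ ≤ U * |s - c| := abs_sub_le_of_deriv hφ₁ hU hc hs'
    _ ≤ U * L := by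
      gcongr
      exact abs_le.mpr ⟨by linarith [hs.1], by linarith [hs.2]⟩
    _ = _ := mul_comm _ _

theorem Partition.width_eq_face_sub (Q : Partition) (hj : j ∈ Finset.Icc 1 Q.n) :
    Q.width j = Q.face j - Q.face (j - 1) := by rw [Q.face_step j hj]; ring

theorem Partition.cell_width_pos_le (P : Partition) (hi : i ∈ Finset.Icc 1 P.n) :
    P.face (i - 1) < P.face i ∧ P.face i - P.face (i - 1) ≤ P.size := by
  obtain ⟨hi1, hi2⟩ := Finset.mem_Icc.mp hi
  have h := P.width_pos i hi
  have h' := P.width_le_size hi1 hi2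
  rw [P.width_eq_face_sub hi] at h h'
  exact ⟨sub_pos.mp h, h'⟩

/-- First-order consistency of the numerical flux through a cell side. Here `φ` is the function
along the grid line through the side and `ψ` its normal derivative along the side. -/
theorem abs_flux_le_first_order
    (hφ : ∀ s ∈ Icc (0 : ℝ) 1, HasDerivWithinAt φ (φ₁ s) (Icc 0 1) s)
    (hφ₁ : ∀ s ∈ Icc (0 : ℝ) 1, HasDerivWithinAt φ₁ (φ₂ s) (Icc 0 1) s)
    (hψ : ∀ s ∈ Icc (0 : ℝ) 1, HasDerivWithinAt ψ (ψ₁ s) (Icc 0 1) s)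
    (hφU : ∀ s ∈ Icc (0 : ℝ) 1, |φ₂ s| ≤ U) (hψU : ∀ s ∈ Icc (0 : ℝ) 1, |ψ₁ s| ≤ U)
    (hc : φ₁ (P.face i) = ψ (Q.node j)) (hP : P.size ≤ h) (hQ : Q.size ≤ h)
    (hi : i ≤ P.n) (hj : j ∈ Finset.Icc 1 Q.n) :
    |-Q.width j * ((φ (P.node (i + 1)) - φ (P.node i)) / P.half i)
      + ∫ t in Q.face (j - 1)..Q.face j, ψ t| ≤ Q.width j * (2 * h * U) := by
  obtain ⟨hj1, hj2⟩ := Finset.mem_Icc.mp hj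
  have hU0 : 0 ≤ U := (abs_nonneg _).trans (hφU 0 (by simp))
  have ha : Q.face (j - 1) ∈ Icc (0 : ℝ) 1 := Q.face_mem (by omega)
  have hb : Q.face j ∈ Icc (0 : ℝ) 1 := Q.face_mem hj2
  have hab : Q.face (j - 1) ≤ Q.face j := Q.face_mono (by omega) hj2
  have hw : 0 ≤ Q.width j := Q.width_nonneg hj2
  have h1 := abs_div_sub_deriv_le (L := h) hφ hφ₁ hφU (P.node_mem_Icc (i := i) (by omega))
    (P.node_mem_Icc (i := i + 1) (by omega)) (P.node_lt_node_succ hi) (P.node_le_face hi)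
    (P.face_le_node_succ hi) ((P.plus_le_size hi).trans hP) ((P.minus_succ_le_size hi).trans hP)
  have hint : IntervalIntegrable ψ volume (Q.face (j - 1)) (Q.face j) :=
    ContinuousOn.intervalIntegrable fun s hs =>
      ((hψ s (ordConnected_Icc.uIcc_subset ha hb hs)).continuousWithinAt).mono
        (ordConnected_Icc.uIcc_subset ha hb)
  have h2 := abs_integral_sub_const_le hint hab (c := ψ (Q.node j)) (K := h * U) fun t ht => by
    have hm := Q.node_mem j hj
    have hwj := (Q.width_le_size hj1 hj2).trans hQ
    rw [Q.width_eq_face_sub hj] at hwj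
    calc _ ≤ U * |t - Q.node j| := abs_sub_le_of_deriv hψ hψU (Q.node_mem_Icc (by omega))
          ⟨ha.1.trans ht.1, ht.2.trans hb.2⟩
      _ ≤ U * h := by
        gcongr
        exact abs_le.mpr ⟨by linarith [ht.1], by linarith [ht.2]⟩
      _ = _ := mul_comm _ _
  rw [← Q.width_eq_face_sub hj] at h2
  rw [← hc] at h2
  change |(φ (P.node (i + 1)) - φ (P.node i)) / P.half i - φ₁ (P.face i)| ≤ h * U at h1
  calc _ = |((∫ t in Q.face (j - 1)..Q.face j, ψ t) - Q.width j * φ₁ (P.face i))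
        - Q.width j * ((φ (P.node (i + 1)) - φ (P.node i)) / P.half i - φ₁ (P.face i))| := by
        congr 1; ring
    _ ≤ Q.width j * (h * U) + Q.width j * (h * U) := by
      refine (abs_sub _ _).trans (add_le_add h2 ?_)
      rw [abs_mul, abs_of_nonneg hw]
      gcongr
    _ = _ := by ring

/-- Second-order consistency of the flux through a cell side, after subtraction of the terms due
to the side not being midway between the nodes and the node not being the centre of the cell. -/
theorem abs_flux_le_second_order
    (hφ : ∀ s ∈ Icc (0 : ℝ) 1, HasDerivWithinAt φ (φ₁ s) (Icc 0 1) s)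
    (hφ₁ : ∀ s ∈ Icc (0 : ℝ) 1, HasDerivWithinAt φ₁ (φ₂ s) (Icc 0 1) s)
    (hφ₂ : ∀ s ∈ Icc (0 : ℝ) 1, HasDerivWithinAt φ₂ (φ₃ s) (Icc 0 1) s)
    (hψ : ∀ s ∈ Icc (0 : ℝ) 1, HasDerivWithinAt ψ (ψ₁ s) (Icc 0 1) s)
    (hψ₁ : ∀ s ∈ Icc (0 : ℝ) 1, HasDerivWithinAt ψ₁ (ψ₂ s) (Icc 0 1) s)
    (hφU : ∀ s ∈ Icc (0 : ℝ) 1, |φ₃ s| ≤ U) (hψU : ∀ s ∈ Icc (0 : ℝ) 1, |ψ₂ s| ≤ U)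
    (hc : φ₁ (P.face i) = ψ (Q.node j)) (hP : P.size ≤ h) (hQ : Q.size ≤ h)
    (hi : i ≤ P.n) (hj : j ∈ Finset.Icc 1 Q.n) :
    |-Q.width j * ((φ (P.node (i + 1)) - φ (P.node i)) / P.half i)
      + (∫ t in Q.face (j - 1)..Q.face j, ψ t)
      + Q.width j * ((P.minus (i + 1) - P.plus i) / 2) * φ₂ (P.face i)
      - (Q.plus j ^ 2 - Q.minus j ^ 2) / 2 * ψ₁ (Q.node j)| ≤ Q.width j * (2 * h ^ 2 * U) := by
  obtain ⟨hj1, hj2⟩ := Finset.mem_Icc.mp hj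
  have ha : Q.face (j - 1) ∈ Icc (0 : ℝ) 1 := Q.face_mem (by omega)
  have hb : Q.face j ∈ Icc (0 : ℝ) 1 := Q.face_mem hj2
  have hw : 0 ≤ Q.width j := Q.width_nonneg hj2
  have hm := Q.node_mem j hj
  have hwj := (Q.width_le_size hj1 hj2).trans hQ
  rw [Q.width_eq_face_sub hj] at hwj
  have h1 := abs_div_sub_second_order_le (h := h) hφ hφ₁ hφ₂ hφU
    (P.node_mem_Icc (i := i) (by omega)) (P.face_mem hi)
    (P.node_mem_Icc (i := i + 1) (by omega)) (P.node_le_face hi)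
    (P.face_le_node_succ hi) (P.node_lt_node_succ hi) ((P.plus_le_size hi).trans hP)
    ((P.minus_succ_le_size hi).trans hP)
  have h2 := abs_integral_sub_first_moment_le (h := h) hψ hψ₁ hψU ha
    (Q.node_mem_Icc (i := j) (by omega)) hb hm.1.le hm.2.le (by linarith) (by linarith)
  rw [← Q.width_eq_face_sub hj, ← hc] at h2
  change |(φ (P.node (i + 1)) - φ (P.node i)) / P.half i - φ₁ (P.face i)
    - (P.minus (i + 1) - P.plus i) / 2 * φ₂ (P.face i)| ≤ _ at h1
  change |(∫ t in Q.face (j - 1)..Q.face j, ψ t) - Q.width j * φ₁ (P.face i)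
    - (Q.plus j ^ 2 - Q.minus j ^ 2) / 2 * ψ₁ (Q.node j)| ≤ _ at h2
  calc _ = |((∫ t in Q.face (j - 1)..Q.face j, ψ t) - Q.width j * φ₁ (P.face i)
          - (Q.plus j ^ 2 - Q.minus j ^ 2) / 2 * ψ₁ (Q.node j))
        - Q.width j * ((φ (P.node (i + 1)) - φ (P.node i)) / P.half i - φ₁ (P.face i)
          - (P.minus (i + 1) - P.plus i) / 2 * φ₂ (P.face i))| := by
        congr 1; ring
    _ ≤ Q.width j * (U * h ^ 2) + Q.width j * (U * h ^ 2) := by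
      refine (abs_sub _ _).trans (add_le_add h2 ?_)
      rw [abs_mul, abs_of_nonneg hw]
      gcongr
    _ = _ := by ring

end Flux

namespace Mesh

variable {τ : Mesh} {u f : ℝ × ℝ → ℝ} {v : ℕ → ℕ → ℝ} {i j : ℕ}

/-- The nodal values of `g`. -/
def nodal (τ : Mesh) (g : ℝ × ℝ → ℝ) (i j : ℕ) : ℝ := g (τ.node i j)

/-- The flux error of the five-point scheme for `g` through the side `x = x_{i+1/2}` of the `j`-th
row of cells. -/
noncomputable def fluxErrorX (τ : Mesh) (g : ℝ × ℝ → ℝ) (i j : ℕ) : ℝ :=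
  -τ.Y.width j * τ.dX (τ.nodal g) i j
    + ∫ t in τ.Y.face (j - 1)..τ.Y.face j, partialX g (τ.X.face i, t)

/-- The flux error of the five-point scheme for `g` through the side `y = y_{j+1/2}` of the `i`-th
column of cells. -/
noncomputable def fluxErrorY (τ : Mesh) (g : ℝ × ℝ → ℝ) (i j : ℕ) : ℝ :=
  -τ.X.width i * τ.dY (τ.nodal g) i j
    + ∫ s in τ.X.face (i - 1)..τ.X.face i, partialY g (s, τ.Y.face j)

/-- The truncation error of the five-point scheme for `-Δg = q` is in divergence form. -/
theorem lap_nodal {g q : ℝ × ℝ → ℝ} (hg : ContDiffOn ℝ 2 g closedSquare)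
    (hq : EqOn q (fun p => -(partialX (partialX g) p + partialY (partialY g) p)) closedSquare)
    (hi : i ∈ Finset.Icc 1 τ.X.n) (hj : j ∈ Finset.Icc 1 τ.Y.n) :
    τ.lap (τ.nodal g) i j = (∫ p in τ.cell i j, q p)
      + (τ.fluxErrorX g i j - τ.fluxErrorX g (i - 1) j)
      + (τ.fluxErrorY g i j - τ.fluxErrorY g i (j - 1)) := by
  obtain ⟨hi1, hi2⟩ := Finset.mem_Icc.mp hi
  obtain ⟨hj1, hj2⟩ := Finset.mem_Icc.mp hj
  have hsub : τ.cell i j ⊆ closedSquare :=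
    prod_mono (Icc_subset_Icc (τ.X.face_mem (by omega)).1 (τ.X.face_mem hi2).2)
      (Icc_subset_Icc (τ.Y.face_mem (by omega)).1 (τ.Y.face_mem hj2).2)
  have hint : ∫ p in τ.cell i j, q p
      = -∫ p in τ.cell i j, (partialX (partialX g) p + partialY (partialY g) p) := by
    rw [← integral_neg]
    exact setIntegral_congr_fun (measurableSet_Icc.prod measurableSet_Icc) (hq.mono hsub)
  rw [hint, cell, Partition.cell, Partition.cell, integral_laplacian_rectangle hg
    (τ.X.face_mem (by omega)).1 (τ.X.face_mono (by omega) hi2) (τ.X.face_mem hi2).2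
    (τ.Y.face_mem (by omega)).1 (τ.Y.face_mono (by omega) hj2) (τ.Y.face_mem hj2).2]
  simp only [fluxErrorX, fluxErrorY, lap, dX, dY, Nat.sub_add_cancel hi1, Nat.sub_add_cancel hj1]
  ring

theorem X_size_le : τ.X.size ≤ τ.size := le_max_left _ _

theorem Y_size_le : τ.Y.size ≤ τ.size := le_max_right _ _

theorem half_le_two_mul_size (P : Partition) (hi : i ≤ P.n) : P.half i ≤ 2 * P.size := by
  rw [P.half_eq]; linarith [P.plus_le_size hi, P.minus_succ_le_size hi]

theorem abs_fluxErrorX_uxx_le (hu : ContDiffOn ℝ (4 : ℕ) u closedSquare)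
    (hi : i ≤ τ.X.n) (hj : j ∈ Finset.Icc 1 τ.Y.n) :
    |τ.fluxErrorX (mixed [.x, .x] u) i j| ≤ τ.Y.width j * (2 * τ.size * cNorm 4 u) := by
  have hy : τ.Y.node j ∈ Icc (0 : ℝ) 1 := τ.Y.node_mem_Icc (by have := Finset.mem_Icc.mp hj; omega)
  have hx := τ.X.face_mem hi
  exact abs_flux_le_first_order (hasDerivWithinAt_mixedX [.x, .x] hu (by simp) hy)
    (hasDerivWithinAt_mixedX [.x, .x, .x] hu (by simp) hy)
    (hasDerivWithinAt_mixedY [.x, .x, .x] hu (by simp) hx)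
    (fun s hs => abs_mixed_le [.x, .x, .x, .x] hu (by simp) ⟨hs, hy⟩)
    (fun t ht => abs_mixed_le [.y, .x, .x, .x] hu (by simp) ⟨hx, ht⟩) rfl X_size_le Y_size_le hi hj

theorem abs_fluxErrorY_uxx_le (hu : ContDiffOn ℝ (4 : ℕ) u closedSquare)
    (hi : i ∈ Finset.Icc 1 τ.X.n) (hj : j ≤ τ.Y.n) :
    |τ.fluxErrorY (mixed [.x, .x] u) i j| ≤ τ.X.width i * (2 * τ.size * cNorm 4 u) := by
  have hx : τ.X.node i ∈ Icc (0 : ℝ) 1 := τ.X.node_mem_Icc (by have := Finset.mem_Icc.mp hi; omega)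
  have hy := τ.Y.face_mem hj
  exact abs_flux_le_first_order (hasDerivWithinAt_mixedY [.x, .x] hu (by simp) hx)
    (hasDerivWithinAt_mixedY [.y, .x, .x] hu (by simp) hx)
    (hasDerivWithinAt_mixedX [.y, .x, .x] hu (by simp) hy)
    (fun t ht => abs_mixed_le [.y, .y, .x, .x] hu (by simp) ⟨hx, ht⟩)
    (fun s hs => abs_mixed_le [.x, .y, .x, .x] hu (by simp) ⟨hs, hy⟩) rfl Y_size_le X_size_le hj hi

/-- The flux error for `u` in the `x` direction is cancelled to second order by `gammaX` and the
first moment along the side, up to the error of `v` as an approximation of `u_xx`. -/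
theorem abs_fluxX_corrected_le (hu : ContDiffOn ℝ (4 : ℕ) u closedSquare)
    (hi : i ≤ τ.X.n) (hj : j ∈ Finset.Icc 1 τ.Y.n) :
    |τ.fluxErrorX u i j - τ.gammaX v i j
      - (τ.Y.plus j ^ 2 - τ.Y.minus j ^ 2) / 2 * mixed [.y, .x] u (τ.X.face i, τ.Y.node j)|
    ≤ τ.Y.width j * (4 * τ.size ^ 2 * cNorm 4 u
        + τ.size / 2 * |τ.nodal (mixed [.x, .x] u) i j - v i j|) := by
  have hjn := (Finset.mem_Icc.mp hj).2
  have hy : τ.Y.node j ∈ Icc (0 : ℝ) 1 := τ.Y.node_mem_Icc (by omega)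
  have hx := τ.X.face_mem hi
  have hw := τ.Y.width_nonneg hjn
  have hs := τ.size_pos
  have hU : 0 ≤ cNorm 4 u := cNorm_nonneg 4 u
  have h1 := abs_flux_le_second_order (P := τ.X) (Q := τ.Y) (U := cNorm 4 u)
    (hasDerivWithinAt_mixedX [] hu (by simp) hy)
    (hasDerivWithinAt_mixedX [.x] hu (by simp) hy)
    (hasDerivWithinAt_mixedX [.x, .x] hu (by simp) hy)
    (hasDerivWithinAt_mixedY [.x] hu (by simp) hx)
    (hasDerivWithinAt_mixedY [.y, .x] hu (by simp) hx)
    (fun s hs => abs_mixed_le [.x, .x, .x] hu (by simp) ⟨hs, hy⟩)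
    (fun t ht => abs_mixed_le [.y, .y, .x] hu (by simp) ⟨hx, ht⟩) rfl X_size_le Y_size_le hi hj
  have h2 := abs_sub_le_of_deriv (hasDerivWithinAt_mixedX [.x, .x] hu (by simp) hy)
    (fun s hs => abs_mixed_le [.x, .x, .x] hu (by simp) ⟨hs, hy⟩)
    (τ.X.node_mem_Icc (i := i) (by omega)) hx
  have hp : |τ.X.face i - τ.X.node i| ≤ τ.size := by
    rw [abs_of_nonneg (sub_nonneg.mpr (τ.X.node_le_face hi))]
    exact (τ.X.plus_le_size hi).trans X_size_le
  have h3 : |(τ.X.minus (i + 1) - τ.X.plus i) / 2| ≤ τ.size / 2 := by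
    rw [abs_le]
    have := τ.X.plus_nonneg hi
    have := τ.X.minus_succ_nonneg hi
    have := (τ.X.plus_le_size hi).trans X_size_le
    have := (τ.X.minus_succ_le_size hi).trans X_size_le
    constructor <;> linarith
  set z := τ.nodal (mixed [.x, .x] u) i j - v i j with hz
  have h4 : |mixed [.x, .x] u (τ.X.face i, τ.Y.node j) - v i j| ≤ cNorm 4 u * τ.size + |z| := by
    calc _ = |(mixed [.x, .x] u (τ.X.face i, τ.Y.node j)
          - mixed [.x, .x] u (τ.X.node i, τ.Y.node j)) + z| := by
          rw [hz, nodal, node]; congr 1; ring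
      _ ≤ _ := (abs_add_le _ _).trans (by gcongr; exact h2.trans (by gcongr))
  have h5 : |τ.Y.width j * ((τ.X.minus (i + 1) - τ.X.plus i) / 2)
      * (mixed [.x, .x] u (τ.X.face i, τ.Y.node j) - v i j)|
      ≤ τ.Y.width j * (τ.size / 2) * (cNorm 4 u * τ.size + |z|) := by
    rw [abs_mul, abs_mul, abs_of_nonneg hw]
    gcongr
  have hid : τ.fluxErrorX u i j - τ.gammaX v i j
      - (τ.Y.plus j ^ 2 - τ.Y.minus j ^ 2) / 2 * mixed [.y, .x] u (τ.X.face i, τ.Y.node j)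
      = (-τ.Y.width j * ((u (τ.X.node (i + 1), τ.Y.node j) - u (τ.X.node i, τ.Y.node j))
            / τ.X.half i)
          + (∫ t in τ.Y.face (j - 1)..τ.Y.face j, partialX u (τ.X.face i, t))
          + τ.Y.width j * ((τ.X.minus (i + 1) - τ.X.plus i) / 2)
            * mixed [.x, .x] u (τ.X.face i, τ.Y.node j)
          - (τ.Y.plus j ^ 2 - τ.Y.minus j ^ 2) / 2 * mixed [.y, .x] u (τ.X.face i, τ.Y.node j))
        - τ.Y.width j * ((τ.X.minus (i + 1) - τ.X.plus i) / 2)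
          * (mixed [.x, .x] u (τ.X.face i, τ.Y.node j) - v i j) := by
    simp only [fluxErrorX, gammaX, dX, nodal, node]
    ring
  rw [hid]
  refine (abs_sub _ _).trans ((add_le_add h1 h5).trans ?_)
  have : 0 ≤ τ.Y.width j * (τ.size ^ 2 * cNorm 4 u) := by positivity
  nlinarith

/-- The flux error for `u` in the `y` direction, corrected by `gammaY`: on the side, `u_yy` is
`-f - u_xx`. -/
theorem abs_fluxY_corrected_le (hu : ContDiffOn ℝ (4 : ℕ) u closedSquare)
    (hf : EqOn f (fun p => -(partialX (partialX u) p + partialY (partialY u) p)) closedSquare)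
    (hi : i ∈ Finset.Icc 1 τ.X.n) (hj : j ≤ τ.Y.n) :
    |τ.fluxErrorY u i j - τ.gammaY f v i j
      - (τ.X.plus i ^ 2 - τ.X.minus i ^ 2) / 2 * mixed [.x, .y] u (τ.X.node i, τ.Y.face j)|
    ≤ τ.X.width i * (4 * τ.size ^ 2 * cNorm 4 u
        + τ.size / 2 * |τ.nodal (mixed [.x, .x] u) i j - v i j|) := by
  have hin := (Finset.mem_Icc.mp hi).2
  have hx : τ.X.node i ∈ Icc (0 : ℝ) 1 := τ.X.node_mem_Icc (by omega)
  have hy := τ.Y.face_mem hj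
  have hw := τ.X.width_nonneg hin
  have hs := τ.size_pos
  have hU : 0 ≤ cNorm 4 u := cNorm_nonneg 4 u
  have h1 := abs_flux_le_second_order (P := τ.Y) (Q := τ.X) (U := cNorm 4 u)
    (hasDerivWithinAt_mixedY [] hu (by simp) hx)
    (hasDerivWithinAt_mixedY [.y] hu (by simp) hx)
    (hasDerivWithinAt_mixedY [.y, .y] hu (by simp) hx)
    (hasDerivWithinAt_mixedX [.y] hu (by simp) hy)
    (hasDerivWithinAt_mixedX [.x, .y] hu (by simp) hy)
    (fun t ht => abs_mixed_le [.y, .y, .y] hu (by simp) ⟨hx, ht⟩)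
    (fun s hs => abs_mixed_le [.x, .x, .y] hu (by simp) ⟨hs, hy⟩) rfl Y_size_le X_size_le hj hi
  have h2 := abs_sub_le_of_deriv (hasDerivWithinAt_mixedY [.x, .x] hu (by simp) hx)
    (fun s hs => abs_mixed_le [.y, .x, .x] hu (by simp) ⟨hx, hs⟩)
    (τ.Y.node_mem_Icc (i := j) (by omega)) hy
  have hp : |τ.Y.face j - τ.Y.node j| ≤ τ.size := by
    rw [abs_of_nonneg (sub_nonneg.mpr (τ.Y.node_le_face hj))]
    exact (τ.Y.plus_le_size hj).trans Y_size_le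
  have h3 : |(τ.Y.minus (j + 1) - τ.Y.plus j) / 2| ≤ τ.size / 2 := by
    rw [abs_le]
    have := τ.Y.plus_nonneg hj
    have := τ.Y.minus_succ_nonneg hj
    have := (τ.Y.plus_le_size hj).trans Y_size_le
    have := (τ.Y.minus_succ_le_size hj).trans Y_size_le
    constructor <;> linarith
  set z := τ.nodal (mixed [.x, .x] u) i j - v i j with hz
  have h4 : |mixed [.x, .x] u (τ.X.node i, τ.Y.face j) - v i j| ≤ cNorm 4 u * τ.size + |z| := by
    calc _ = |(mixed [.x, .x] u (τ.X.node i, τ.Y.face j)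
          - mixed [.x, .x] u (τ.X.node i, τ.Y.node j)) + z| := by
          rw [hz, nodal, node]; congr 1; ring
      _ ≤ _ := (abs_add_le _ _).trans (by gcongr; exact h2.trans (by gcongr))
  have h5 : |τ.X.width i * ((τ.Y.minus (j + 1) - τ.Y.plus j) / 2)
      * (mixed [.x, .x] u (τ.X.node i, τ.Y.face j) - v i j)|
      ≤ τ.X.width i * (τ.size / 2) * (cNorm 4 u * τ.size + |z|) := by
    rw [abs_mul, abs_mul, abs_of_nonneg hw]
    gcongr
  have hfv : f (τ.X.node i, τ.Y.face j) = -(mixed [.x, .x] u (τ.X.node i, τ.Y.face j)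
      + mixed [.y, .y] u (τ.X.node i, τ.Y.face j)) := hf ⟨hx, hy⟩
  have hid : τ.fluxErrorY u i j - τ.gammaY f v i j
      - (τ.X.plus i ^ 2 - τ.X.minus i ^ 2) / 2 * mixed [.x, .y] u (τ.X.node i, τ.Y.face j)
      = (-τ.X.width i * ((u (τ.X.node i, τ.Y.node (j + 1)) - u (τ.X.node i, τ.Y.node j))
            / τ.Y.half j)
          + (∫ s in τ.X.face (i - 1)..τ.X.face i, partialY u (s, τ.Y.face j))
          + τ.X.width i * ((τ.Y.minus (j + 1) - τ.Y.plus j) / 2)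
            * mixed [.y, .y] u (τ.X.node i, τ.Y.face j)
          - (τ.X.plus i ^ 2 - τ.X.minus i ^ 2) / 2 * mixed [.x, .y] u (τ.X.node i, τ.Y.face j))
        + τ.X.width i * ((τ.Y.minus (j + 1) - τ.Y.plus j) / 2)
          * (mixed [.x, .x] u (τ.X.node i, τ.Y.face j) - v i j) := by
    simp only [fluxErrorY, gammaY, dY, nodal, node, hfv]
    ring
  rw [hid]
  refine (abs_add_le _ _).trans ((add_le_add h1 h5).trans ?_)
  have : 0 ≤ τ.X.width i * (τ.size ^ 2 * cNorm 4 u) := by positivity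
  nlinarith

end Mesh

namespace Mesh

variable {τ : Mesh} {u f : ℝ × ℝ → ℝ} {v : ℕ → ℕ → ℝ} {i j : ℕ}

/-! ### Consistency of the correction term -/

theorem abs_half_sq_mul_le {κ r h K q d ζ : ℝ} (hκ : 0 ≤ κ) (hr : 0 ≤ r) (hrh : r ≤ h)
    (hq : |q - d| ≤ K + |ζ|) :
    |r ^ 2 / 2 * (κ * q - κ * d)| ≤ κ * r * (h / 2 * (K + |ζ|)) := by
  have h1 : |r ^ 2 / 2 * (κ * q - κ * d)| = κ * r * (r / 2 * |q - d|) := by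
    rw [← mul_sub, abs_mul, abs_mul, abs_of_nonneg hκ, abs_of_nonneg (by positivity)]
    ring
  rw [h1]
  have : 0 ≤ h / 2 := by linarith
  gcongr

/-- The error of `v` as an approximation of `u_xx`, at the nodes. -/
noncomputable def uxxError (τ : Mesh) (u : ℝ × ℝ → ℝ) (v : ℕ → ℕ → ℝ) (i j : ℕ) : ℝ :=
  τ.nodal (mixed [.x, .x] u) i j - v i j

theorem dX_uxxError :
    τ.dX (τ.uxxError u v) i j = τ.dX (τ.nodal (mixed [.x, .x] u)) i j - τ.dX v i j := by
  simp only [dX, uxxError]; ring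

theorem dY_uxxError :
    τ.dY (τ.uxxError u v) i j = τ.dY (τ.nodal (mixed [.x, .x] u)) i j - τ.dY v i j := by
  simp only [dY, uxxError]; ring

theorem abs_dX_uxx_sub_le (hu : ContDiffOn ℝ (4 : ℕ) u closedSquare) (hi : i ≤ τ.X.n)
    (hj : j ≤ τ.Y.n + 1) {x : ℝ} (h1 : τ.X.node i ≤ x) (h2 : x ≤ τ.X.node (i + 1)) :
    |τ.dX (τ.nodal (mixed [.x, .x] u)) i j - mixed [.x, .x, .x] u (x, τ.Y.node j)|
      ≤ 2 * τ.size * cNorm 4 u := by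
  have hy := τ.Y.node_mem_Icc hj
  have hh : τ.X.node (i + 1) - τ.X.node i ≤ 2 * τ.size :=
    (half_le_two_mul_size τ.X hi).trans (by linarith [X_size_le (τ := τ)])
  exact abs_div_sub_deriv_le (hasDerivWithinAt_mixedX [.x, .x] hu (by simp) hy)
    (hasDerivWithinAt_mixedX [.x, .x, .x] hu (by simp) hy)
    (fun s hs => abs_mixed_le [.x, .x, .x, .x] hu (by simp) ⟨hs, hy⟩)
    (τ.X.node_mem_Icc (by omega)) (τ.X.node_mem_Icc (by omega)) (τ.X.node_lt_node_succ hi)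
    h1 h2 (by linarith) (by linarith)

theorem abs_dY_uxx_sub_le (hu : ContDiffOn ℝ (4 : ℕ) u closedSquare) (hi : i ≤ τ.X.n + 1)
    (hj : j ≤ τ.Y.n) {y : ℝ} (h1 : τ.Y.node j ≤ y) (h2 : y ≤ τ.Y.node (j + 1)) :
    |τ.dY (τ.nodal (mixed [.x, .x] u)) i j - mixed [.y, .x, .x] u (τ.X.node i, y)|
      ≤ 2 * τ.size * cNorm 4 u := by
  have hx := τ.X.node_mem_Icc hi
  have hh : τ.Y.node (j + 1) - τ.Y.node j ≤ 2 * τ.size :=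
    (half_le_two_mul_size τ.Y hj).trans (by linarith [Y_size_le (τ := τ)])
  exact abs_div_sub_deriv_le (hasDerivWithinAt_mixedY [.x, .x] hu (by simp) hx)
    (hasDerivWithinAt_mixedY [.y, .x, .x] hu (by simp) hx)
    (fun s hs => abs_mixed_le [.y, .y, .x, .x] hu (by simp) ⟨hx, hs⟩)
    (τ.Y.node_mem_Icc (by omega)) (τ.Y.node_mem_Icc (by omega)) (τ.Y.node_lt_node_succ hj)
    h1 h2 (by linarith) (by linarith)

theorem abs_uxy_diffX_sub_le (hu : ContDiffOn ℝ (4 : ℕ) u closedSquare)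
    (hi : i ∈ Finset.Icc 1 τ.X.n) (hj : j ≤ τ.Y.n + 1) :
    |(mixed [.y, .x] u (τ.X.face i, τ.Y.node j) - mixed [.y, .x] u (τ.X.face (i - 1), τ.Y.node j))
        / τ.X.width i - mixed [.y, .x, .x] u (τ.X.node i, τ.Y.node j)| ≤ τ.size * cNorm 4 u := by
  obtain ⟨hi1, hi2⟩ := Finset.mem_Icc.mp hi
  have hy := τ.Y.node_mem_Icc hj
  have hm := τ.X.node_mem i hi
  obtain ⟨hw1, hw2⟩ := τ.X.cell_width_pos_le hi
  have hs := X_size_le (τ := τ)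
  rw [τ.X.width_eq_face_sub hi, mixed_eq_mixed (l := [.y, .x, .x]) (l' := [.x, .y, .x]) hu
    (by simp) rfl rfl ⟨τ.X.node_mem_Icc (by omega), hy⟩]
  exact abs_div_sub_deriv_le (hasDerivWithinAt_mixedX [.y, .x] hu (by simp) hy)
    (hasDerivWithinAt_mixedX [.x, .y, .x] hu (by simp) hy)
    (fun s hs => abs_mixed_le [.x, .x, .y, .x] hu (by simp) ⟨hs, hy⟩)
    (τ.X.face_mem (by omega)) (τ.X.face_mem hi2) hw1 hm.1.le hm.2.le (by linarith) (by linarith)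

theorem abs_uxy_diffY_sub_le (hu : ContDiffOn ℝ (4 : ℕ) u closedSquare) (hi : i ≤ τ.X.n + 1)
    (hj : j ∈ Finset.Icc 1 τ.Y.n) :
    |(mixed [.x, .y] u (τ.X.node i, τ.Y.face j) - mixed [.x, .y] u (τ.X.node i, τ.Y.face (j - 1)))
        / τ.Y.width j - mixed [.x, .y, .y] u (τ.X.node i, τ.Y.node j)| ≤ τ.size * cNorm 4 u := by
  obtain ⟨hj1, hj2⟩ := Finset.mem_Icc.mp hj
  have hx := τ.X.node_mem_Icc hi
  have hm := τ.Y.node_mem j hj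
  obtain ⟨hw1, hw2⟩ := τ.Y.cell_width_pos_le hj
  have hs := Y_size_le (τ := τ)
  rw [τ.Y.width_eq_face_sub hj, mixed_eq_mixed (l := [.x, .y, .y]) (l' := [.y, .x, .y]) hu
    (by simp) rfl rfl ⟨hx, τ.Y.node_mem_Icc (by omega)⟩]
  exact abs_div_sub_deriv_le (hasDerivWithinAt_mixedY [.x, .y] hu (by simp) hx)
    (hasDerivWithinAt_mixedY [.y, .x, .y] hu (by simp) hx)
    (fun t ht => abs_mixed_le [.y, .y, .x, .y] hu (by simp) ⟨hx, ht⟩)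
    (τ.Y.face_mem (by omega)) (τ.Y.face_mem hj2) hw1 hm.1.le hm.2.le (by linarith) (by linarith)

theorem partialX_source (hu : ContDiffOn ℝ (4 : ℕ) u closedSquare)
    (hf : EqOn f (fun p => -(partialX (partialX u) p + partialY (partialY u) p)) closedSquare) :
    EqOn (partialX f) (fun p => -(mixed [.x, .x, .x] u p + mixed [.x, .y, .y] u p))
      closedSquare := fun _ hp => by
  rw [partialX_congr hf hp]
  exact partialX_neg_add (by exact_mod_cast contDiffOn_mixed (k := 1) [.x, .x] hu (by simp))
    (by exact_mod_cast contDiffOn_mixed (k := 1) [.y, .y] hu (by simp)) hp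

/-- What is left of the truncation error after the flux corrections, minus `delta`. -/
noncomputable def momentDefect (τ : Mesh) (u f : ℝ × ℝ → ℝ) (v : ℕ → ℕ → ℝ) (i j : ℕ) : ℝ :=
  (τ.Y.plus j ^ 2 - τ.Y.minus j ^ 2) / 2
      * (mixed [.y, .x] u (τ.X.face i, τ.Y.node j)
        - mixed [.y, .x] u (τ.X.face (i - 1), τ.Y.node j))
    + (τ.X.plus i ^ 2 - τ.X.minus i ^ 2) / 2
      * (mixed [.x, .y] u (τ.X.node i, τ.Y.face j)
        - mixed [.x, .y] u (τ.X.node i, τ.Y.face (j - 1)))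
    - τ.delta f v i j

/-- The term `delta` reproduces the differences of the first moments of the normal derivatives:
`h_i u_xxy` is compared with `h_i ∂_y v`, and `k_j u_xyy` with `k_j (-f_x - ∂_x v)`. -/
theorem abs_momentDefect_le (hu : ContDiffOn ℝ (4 : ℕ) u closedSquare)
    (hf : EqOn f (fun p => -(partialX (partialX u) p + partialY (partialY u) p)) closedSquare)
    (hi : i ∈ Finset.Icc 1 τ.X.n) (hj : j ∈ Finset.Icc 1 τ.Y.n) :
    |τ.momentDefect u f v i j|
      ≤ τ.sourceBound (4 * τ.size ^ 2 * cNorm 4 u) (τ.size / 2) (τ.uxxError u v) i j := by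
  obtain ⟨hi1, hi2⟩ := Finset.mem_Icc.mp hi
  obtain ⟨hj1, hj2⟩ := Finset.mem_Icc.mp hj
  have hx := τ.X.node_mem_Icc (i := i) (by omega)
  have hx' := τ.X.node_mem_Icc (i := i - 1) (by omega)
  have hy := τ.Y.node_mem_Icc (i := j) (by omega)
  have hi' : i - 1 + 1 = i := by omega
  have hj' : j - 1 + 1 = j := by omega
  have hw := τ.X.width_pos i hi
  have hk := τ.Y.width_pos j hj
  have hxs := X_size_le (τ := τ)
  have hys := Y_size_le (τ := τ)
  have hU : 0 ≤ cNorm 4 u := cNorm_nonneg 4 u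
  set U := cNorm 4 u
  set z := τ.uxxError u v with hz
  have cX := abs_uxy_diffX_sub_le hu hi (j := j) (by omega)
  have cY := abs_uxy_diffY_sub_le hu (i := i) (by omega) hj
  set qX := (mixed [.y, .x] u (τ.X.face i, τ.Y.node j)
    - mixed [.y, .x] u (τ.X.face (i - 1), τ.Y.node j)) / τ.X.width i with hqX
  set qY := (mixed [.x, .y] u (τ.X.node i, τ.Y.face j)
    - mixed [.x, .y] u (τ.X.node i, τ.Y.face (j - 1))) / τ.Y.width j with hqY
  -- The comparison of `u_xxy` with the two divided differences of `v` in `y`.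
  have a1 : |qX - τ.dY v i j| ≤ 3 * τ.size * U + |τ.dY z i j| := by
    have h := abs_dY_uxx_sub_le hu (i := i) (j := j) (by omega) (by omega) le_rfl
      (τ.Y.node_lt_node_succ hj2).le
    have e := dY_uxxError (τ := τ) (u := u) (v := v) (i := i) (j := j)
    rw [← hz] at e
    have := abs_le.mp h; have := abs_le.mp cX
    have := le_abs_self (τ.dY z i j); have := neg_abs_le (τ.dY z i j)
    exact abs_le.mpr ⟨by linarith, by linarith⟩
  have a2 : |qX - τ.dY v i (j - 1)| ≤ 3 * τ.size * U + |τ.dY z i (j - 1)| := by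
    have h := abs_dY_uxx_sub_le hu (τ := τ) (i := i) (j := j - 1) (y := τ.Y.node j) (by omega)
      (by omega) (by have := τ.Y.node_lt_node_succ (i := j - 1) (by omega); rw [hj'] at this;
                     exact this.le) (by rw [hj'])
    have e := dY_uxxError (τ := τ) (u := u) (v := v) (i := i) (j := j - 1)
    rw [← hz] at e
    have := abs_le.mp h; have := abs_le.mp cX
    have := le_abs_self (τ.dY z i (j - 1)); have := neg_abs_le (τ.dY z i (j - 1))
    exact abs_le.mpr ⟨by linarith, by linarith⟩
  -- The comparison of `u_xyy = -f_x - u_xxx` with the two approximations in the correction.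
  have a3 : |qY - (-partialX f (τ.node i j) - τ.dX v i j)|
      ≤ 3 * τ.size * U + |τ.dX z i j| := by
    have h := abs_dX_uxx_sub_le hu (i := i) (j := j) (by omega) (by omega) le_rfl
      (τ.X.node_lt_node_succ hi2).le
    have e := dX_uxxError (τ := τ) (u := u) (v := v) (i := i) (j := j)
    rw [← hz] at e
    have hfx := partialX_source hu hf (show (τ.X.node i, τ.Y.node j) ∈ closedSquare from ⟨hx, hy⟩)
    rw [node, hfx]
    have := abs_le.mp h; have := abs_le.mp cY
    have := le_abs_self (τ.dX z i j); have := neg_abs_le (τ.dX z i j)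
    exact abs_le.mpr ⟨by linarith, by linarith⟩
  have a4 : |qY - (-partialX f (τ.node (i - 1) j) - τ.dX v (i - 1) j)|
      ≤ 5 * τ.size * U + |τ.dX z (i - 1) j| := by
    have hlt := τ.X.node_lt_node_succ (i := i - 1) (by omega)
    have h := abs_dX_uxx_sub_le hu (τ := τ) (i := i - 1) (j := j) (by omega) (by omega) le_rfl
      hlt.le
    have e := dX_uxxError (τ := τ) (u := u) (v := v) (i := i - 1) (j := j)
    rw [← hz] at e
    have hfx := partialX_source hu hf
      (show (τ.X.node (i - 1), τ.Y.node j) ∈ closedSquare from ⟨hx', hy⟩)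
    have hshift : |mixed [.x, .y, .y] u (τ.X.node i, τ.Y.node j)
        - mixed [.x, .y, .y] u (τ.X.node (i - 1), τ.Y.node j)| ≤ 2 * τ.size * U := by
      have hh := half_le_two_mul_size τ.X (i := i - 1) (by omega)
      rw [Partition.half, hi'] at hh
      rw [hi'] at hlt
      calc _ ≤ U * |τ.X.node i - τ.X.node (i - 1)| :=
            abs_sub_le_of_deriv (hasDerivWithinAt_mixedX [.x, .y, .y] hu (by simp) hy)
              (fun s hs => abs_mixed_le [.x, .x, .y, .y] hu (by simp) ⟨hs, hy⟩) hx' hx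
        _ ≤ U * (2 * τ.size) := by
          rw [abs_of_pos (sub_pos.mpr hlt)]
          gcongr
          linarith
        _ = _ := mul_comm _ _
    rw [node, hfx]
    have := abs_le.mp h; have := abs_le.mp cY; have := abs_le.mp hshift
    have := le_abs_self (τ.dX z (i - 1) j); have := neg_abs_le (τ.dX z (i - 1) j)
    exact abs_le.mpr ⟨by linarith, by linarith⟩
  have hxm := τ.X.minus_pos hi1 hi2
  have hxp := τ.X.plus_pos hi1 hi2
  have hym := τ.Y.minus_pos hj1 hj2
  have hyp := τ.Y.plus_pos hj1 hj2
  have hxw := τ.X.minus_add_plus hi1 hi2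
  have hyw := τ.Y.minus_add_plus hj1 hj2
  have hxle := τ.X.width_le_size hi1 hi2
  have hyle := τ.Y.width_le_size hj1 hj2
  have b1 := abs_half_sq_mul_le (h := τ.size) hw.le hyp.le (by linarith) a1
  have b2 := abs_half_sq_mul_le (h := τ.size) hw.le hym.le (by linarith) a2
  have b3 := abs_half_sq_mul_le (h := τ.size) hk.le hxp.le (by linarith) a3
  have b4 := abs_half_sq_mul_le (h := τ.size) hk.le hxm.le (by linarith) a4
  have dX_eq : mixed [.y, .x] u (τ.X.face i, τ.Y.node j)
      - mixed [.y, .x] u (τ.X.face (i - 1), τ.Y.node j) = τ.X.width i * qX := by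
    rw [hqX, mul_div_cancel₀ _ hw.ne']
  have dY_eq : mixed [.x, .y] u (τ.X.node i, τ.Y.face j)
      - mixed [.x, .y] u (τ.X.node i, τ.Y.face (j - 1)) = τ.Y.width j * qY := by
    rw [hqY, mul_div_cancel₀ _ hk.ne']
  have hid : τ.momentDefect u f v i j
      = τ.Y.plus j ^ 2 / 2 * (τ.X.width i * qX - τ.X.width i * τ.dY v i j)
        - τ.Y.minus j ^ 2 / 2 * (τ.X.width i * qX - τ.X.width i * τ.dY v i (j - 1))
        + τ.X.plus i ^ 2 / 2 * (τ.Y.width j * qY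
          - τ.Y.width j * (-partialX f (τ.node i j) - τ.dX v i j))
        - τ.X.minus i ^ 2 / 2 * (τ.Y.width j * qY
          - τ.Y.width j * (-partialX f (τ.node (i - 1) j) - τ.dX v (i - 1) j)) := by
    rw [momentDefect, dX_eq, dY_eq, delta]
    ring
  rw [hid]
  refine ((abs_sub _ _).trans (add_le_add ((abs_add_le _ _).trans
    (add_le_add ((abs_sub _ _).trans (add_le_add b1 b2)) b3)) b4)).trans ?_
  have e1 : τ.X.width i * τ.Y.plus j + τ.X.width i * τ.Y.minus j
      = τ.X.width i * τ.Y.width j := by rw [← hyw]; ring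
  have e2 : τ.Y.width j * τ.X.plus i + τ.Y.width j * τ.X.minus i
      = τ.X.width i * τ.Y.width j := by rw [← hxw]; ring
  have hsz := τ.size_pos
  have e3 : 0 ≤ τ.Y.width j * τ.X.plus i * (τ.size ^ 2 * U) := by positivity
  have e1' : (τ.X.width i * τ.Y.plus j + τ.X.width i * τ.Y.minus j) * (τ.size ^ 2 * U)
      = τ.X.width i * τ.Y.width j * (τ.size ^ 2 * U) := by rw [e1]
  have e2' : (τ.Y.width j * τ.X.plus i + τ.Y.width j * τ.X.minus i) * (τ.size ^ 2 * U)
      = τ.X.width i * τ.Y.width j * (τ.size ^ 2 * U) := by rw [e2]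
  rw [sourceBound]
  linarith

/-! ### Error estimates -/

theorem uxxError_vanishesOnBoundary
    (hf : EqOn f (fun p => -(partialX (partialX u) p + partialY (partialY u) p)) closedSquare)
    (hu0 : ∀ p ∈ frontier openSquare, u p = 0) (hv : τ.IsApproxUxx f v) :
    τ.VanishesOnBoundary (τ.uxxError u v) := by
  have hbt {i j : ℕ} (hi : i ≤ τ.X.n + 1) (hy : τ.Y.node j = 0 ∨ τ.Y.node j = 1) :
      mixed [.x, .x] u (τ.node i j) = 0 :=
    partialX_partialX_eq_zero (τ.X.node_mem_Icc hi) fun s hs =>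
      hu0 _ (mem_frontier_of_bottom_or_top hs hy)
  have hlr {i j : ℕ} (hx : τ.X.node i = 0 ∨ τ.X.node i = 1) (hi : i ≤ τ.X.n + 1)
      (hj : j ≤ τ.Y.n + 1) : mixed [.x, .x] u (τ.node i j) = τ.bdryV f i j := by
    rw [bdryV]
    split_ifs with h
    · refine hbt hi ?_
      rcases h with rfl | rfl
      · exact Or.inl τ.Y.node_zero
      · exact Or.inr τ.Y.node_last
    · have h1 : partialY (partialY u) (τ.node i j) = 0 :=
        partialY_partialY_eq_zero (τ.Y.node_mem_Icc hj) fun t ht =>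
          hu0 _ (mem_frontier_of_left_or_right hx ht)
      rw [hf (show τ.node i j ∈ closedSquare from ⟨τ.X.node_mem_Icc hi, τ.Y.node_mem_Icc hj⟩)]
      simp only [h1, mixed]
      ring
  refine ⟨fun j hj => ⟨?_, ?_⟩, fun i hi => ⟨?_, ?_⟩⟩
  · rw [uxxError, nodal, hv.left j hj, hlr (Or.inl τ.X.node_zero) (by omega) hj, sub_self]
  · rw [uxxError, nodal, hv.right j hj, hlr (Or.inr τ.X.node_last) le_rfl hj, sub_self]
  · rw [uxxError, nodal, hv.bottom i hi, hbt hi (Or.inl τ.Y.node_zero)]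
    simp [bdryV]
  · rw [uxxError, nodal, hv.top i hi, hbt hi (Or.inr τ.Y.node_last)]
    simp [bdryV]

/-- First-order convergence of the approximation of `u_xx`, in the energy norm. -/
theorem energy_uxxError_le (hu : ContDiffOn ℝ (4 : ℕ) u closedSquare)
    (hf : EqOn f (fun p => -(partialX (partialX u) p + partialY (partialY u) p)) closedSquare)
    (hu0 : ∀ p ∈ frontier openSquare, u p = 0) (hv : τ.IsApproxUxx f v) :
    τ.energyX (τ.uxxError u v) + τ.energyY (τ.uxxError u v)
      ≤ 20 * (2 * τ.size * cNorm 4 u) ^ 2 := by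
  have hvan := uxxError_vanishesOnBoundary hf hu0 hv
  have hg : ContDiffOn ℝ 2 (mixed [.x, .x] u) closedSquare := by
    exact_mod_cast contDiffOn_mixed (k := 2) [.x, .x] hu (by simp)
  have hq : EqOn (partialX (partialX f)) (fun p => -(partialX (partialX (mixed [.x, .x] u)) p
      + partialY (partialY (mixed [.x, .x] u)) p)) closedSquare := fun p hp => by
    rw [partialX_congr (partialX_source hu hf) hp, partialX_neg_add
      (by exact_mod_cast contDiffOn_mixed (k := 1) [.x, .x, .x] hu (by simp))
      (by exact_mod_cast contDiffOn_mixed (k := 1) [.x, .y, .y] hu (by simp)) hp]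
    have := mixed_eq_mixed (l := [.x, .x, .y, .y]) (l' := [.y, .y, .x, .x]) hu (by simp) rfl rfl hp
    simp only [mixed] at this ⊢
    rw [this]
  have h := energy_le (τ := τ) (F := τ.fluxErrorX (mixed [.x, .x] u))
    (G := τ.fluxErrorY (mixed [.x, .x] u)) (D := fun _ _ => 0) (a := 2 * τ.size * cNorm 4 u)
    (b := 0) hvan hvan
    (fun i hi j hj => by
      rw [show τ.uxxError u v = fun i j => τ.nodal (mixed [.x, .x] u) i j - v i j from rfl,
        lap_sub, lap_nodal hg hq hi hj, hv.scheme i hi j hj]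
      ring)
    (fun i hi j hj => by simpa using abs_fluxErrorX_uxx_le hu hi hj)
    (fun i hi j hj => by simpa using abs_fluxErrorY_uxx_le hu hi hj)
    (fun i hi j hj => by
      have hw := (τ.X.width_pos i hi).le
      have hk := (τ.Y.width_pos j hj).le
      have hs := τ.size_pos
      have hU := cNorm_nonneg 4 u
      simp only [sourceBound, abs_zero, zero_mul, mul_zero, add_zero]
      positivity)
  simpa using h

theorem error_vanishesOnBoundary (w : ℕ → ℕ → ℝ) : τ.VanishesOnBoundary (τ.error u w) := by
  refine ⟨fun j hj => ⟨?_, ?_⟩, fun i hi => ⟨?_, ?_⟩⟩ <;>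
  · rw [error, if_neg]
    simp only [Finset.mem_Icc]
    omega

theorem error_eq (hu0 : ∀ p ∈ frontier openSquare, u p = 0) {rhs w : ℕ → ℕ → ℝ}
    (hw : τ.IsSolution (fun _ _ => 0) rhs w) (hi : i ≤ τ.X.n + 1) (hj : j ≤ τ.Y.n + 1) :
    τ.error u w i j = τ.nodal u i j - w i j := by
  by_cases h : i ∈ Finset.Icc 1 τ.X.n ∧ j ∈ Finset.Icc 1 τ.Y.n
  · rw [error, if_pos h, nodal]
  rw [error, if_neg h, nodal, node]
  simp only [Finset.mem_Icc] at h
  rcases (by omega : i = 0 ∨ i = τ.X.n + 1 ∨ j = 0 ∨ j = τ.Y.n + 1) with rfl | rfl | rfl | rfl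
  · rw [hw.left j hj, hu0 _ (mem_frontier_of_left_or_right (Or.inl τ.X.node_zero)
      (τ.Y.node_mem_Icc hj)), sub_self]
  · rw [hw.right j hj, hu0 _ (mem_frontier_of_left_or_right (Or.inr τ.X.node_last)
      (τ.Y.node_mem_Icc hj)), sub_self]
  · rw [hw.bottom i hi, hu0 _ (mem_frontier_of_bottom_or_top (τ.X.node_mem_Icc hi)
      (Or.inl τ.Y.node_zero)), sub_self]
  · rw [hw.top i hi, hu0 _ (mem_frontier_of_bottom_or_top (τ.X.node_mem_Icc hi)
      (Or.inr τ.Y.node_last)), sub_self]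

/-- Second-order convergence of the correction, in the energy norm. -/
theorem energy_error_le (hu : ContDiffOn ℝ (4 : ℕ) u closedSquare)
    (hf : EqOn f (fun p => -(partialX (partialX u) p + partialY (partialY u) p)) closedSquare)
    (hu0 : ∀ p ∈ frontier openSquare, u p = 0) (hv : τ.IsApproxUxx f v) {u1 : ℕ → ℕ → ℝ}
    (hu1 : τ.IsCorrection f v u1) :
    τ.energyX (τ.error u u1) + τ.energyY (τ.error u u1)
      ≤ (30 * τ.size ^ 2 * cNorm 4 u) ^ 2 := by
  have hvan := error_vanishesOnBoundary (τ := τ) (u := u) u1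
  have hzvan := uxxError_vanishesOnBoundary hf hu0 hv
  have hu2 : ContDiffOn ℝ 2 u closedSquare := hu.of_le (by norm_num)
  have h := energy_le (τ := τ)
    (F := fun i j => τ.fluxErrorX u i j - τ.gammaX v i j
      - (τ.Y.plus j ^ 2 - τ.Y.minus j ^ 2) / 2 * mixed [.y, .x] u (τ.X.face i, τ.Y.node j))
    (G := fun i j => τ.fluxErrorY u i j - τ.gammaY f v i j
      - (τ.X.plus i ^ 2 - τ.X.minus i ^ 2) / 2 * mixed [.x, .y] u (τ.X.node i, τ.Y.face j))
    (D := τ.momentDefect u f v) (a := 4 * τ.size ^ 2 * cNorm 4 u) (b := τ.size / 2) hvan hzvan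
    (fun i hi j hj => by
      obtain ⟨hi1, hi2⟩ := Finset.mem_Icc.mp hi
      obtain ⟨hj1, hj2⟩ := Finset.mem_Icc.mp hj
      have e : τ.lap (τ.error u u1) i j = τ.lap (fun i j => τ.nodal u i j - u1 i j) i j := by
        simp only [lap]
        rw [error_eq hu0 hu1 (by omega) (by omega), error_eq hu0 hu1 (by omega) (by omega),
          error_eq hu0 hu1 (by omega) (by omega), error_eq hu0 hu1 (by omega) (by omega),
          error_eq hu0 hu1 (by omega) (by omega)]
      rw [e, lap_sub, lap_nodal hu2 hf hi hj, hu1.scheme i hi j hj, momentDefect]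
      ring)
    (fun i hi j hj => abs_fluxX_corrected_le hu hi hj)
    (fun i hi j hj => abs_fluxY_corrected_le hu hf hi hj)
    (fun i hi j hj => abs_momentDefect_le hu hf hi hj)
  have hz := energy_uxxError_le hu hf hu0 hv
  calc _ ≤ _ := h
    _ ≤ 20 * (4 * τ.size ^ 2 * cNorm 4 u) ^ 2
        + 16 * (τ.size / 2) ^ 2 * (20 * (2 * τ.size * cNorm 4 u) ^ 2) := by gcongr
    _ = 640 * (τ.size ^ 2 * cNorm 4 u) ^ 2 := by ring
    _ ≤ 900 * (τ.size ^ 2 * cNorm 4 u) ^ 2 := by gcongr; norm_num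
    _ = _ := by ring

end Mesh

end FVCorrection

theorem theorem6 :
    ∃ c : ℝ, 0 < c ∧ ∀ u f : ℝ × ℝ → ℝ,
      ContDiffOn ℝ 4 u closedSquare →
      ContinuousOn f closedSquare →
      (∀ p ∈ openSquare, -(partialX (partialX u) p + partialY (partialY u) p) = f p) →
      (∀ p ∈ frontier openSquare, u p = 0) →
      ∀ τ : Mesh,
        (∃! uh : ℕ → ℕ → ℝ, τ.IsBasic f uh) ∧
        (∃! v : ℕ → ℕ → ℝ, τ.IsApproxUxx f v) ∧
        ∀ v : ℕ → ℕ → ℝ, τ.IsApproxUxx f v →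
          (∃! u1 : ℕ → ℕ → ℝ, τ.IsCorrection f v u1) ∧
          ∀ u1 : ℕ → ℕ → ℝ, τ.IsCorrection f v u1 →
            τ.normH1 (τ.error u u1) ≤ c * τ.size ^ 2 * cNorm 4 u ∧
            τ.normL2Mod (τ.error u u1) ≤ c * τ.size ^ 2 * cNorm 4 u ∧
            τ.normL2 (τ.error u u1) ≤ c * τ.size ^ 2 * cNorm 4 u := by
  refine ⟨30, by norm_num, fun u f hu hfc hpde hu0 τ => ⟨Mesh.existsUnique_isSolution _ _,
    Mesh.existsUnique_isSolution _ _, fun v hv => ⟨Mesh.existsUnique_isSolution _ _,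
      fun u1 hu1 => ?_⟩⟩⟩
  have hu' : ContDiffOn ℝ (4 : ℕ) u closedSquare := by exact_mod_cast hu
  -- The equation extends from the open square to its closure by continuity.
  have hf : EqOn f (fun p => -(partialX (partialX u) p + partialY (partialY u) p))
      closedSquare := by
    refine EqOn.of_subset_closure (s := openSquare) (fun p hp => (hpde p hp).symm) hfc ?_
      (closure_openSquare ▸ subset_closure) closure_openSquare.ge
    exact ((contDiffOn_mixed (k := 0) [.x, .x] hu' (by simp)).continuousOn.add
      (contDiffOn_mixed (k := 0) [.y, .y] hu' (by simp)).continuousOn).neg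
  have hE := Mesh.energy_error_le hu' hf hu0 hv hu1
  have hvan := Mesh.error_vanishesOnBoundary (τ := τ) (u := u) u1
  have hY := Mesh.energyY_nonneg (τ := τ) (w := τ.error u u1)
  have hc : 0 ≤ 30 * τ.size ^ 2 * cNorm 4 u :=
    mul_nonneg (by positivity) (cNorm_nonneg 4 u)
  refine ⟨?_, ?_, ?_⟩
  · exact Real.sqrt_le_iff.mpr ⟨hc, hE⟩
  · refine Real.sqrt_le_iff.mpr ⟨hc, ?_⟩
    have h := Mesh.sum_half_width_sq_le hvan
    simp only [mul_comm (τ.X.half _)] at h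
    linarith
  · refine Real.sqrt_le_iff.mpr ⟨hc, ?_⟩
    have h := Mesh.sum_width_width_sq_le hvan
    linarith
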